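/- Let $\mathbb{T}=\mathbb{R}/\mathbb{Z}$ with Lebesgue measure $|\cdot|$ of total mass one. Fix constants $3<\gamma\le K$, $K_1>0$ and $c>0$. **The model.** For $\delta_0>0$ and an integer $N\ge 1$, Model A$'$ with parameters $(\gamma,K,K_1,c,\delta_0,N)$ consists of maps $T_n:\mathbb{T}\to\mathbb{T}$ of class $C^{1+\mathrm{Lip}}$ and arcs $W_n\subset\mathbb{T}$ (the backward gates), $n\in\mathbb{Z}$, such that for all $n\in\mathbb{Z}$ and all $x,y\in\mathbb{T}$ 1. $\gamma\le|T_n'(x)|\le K$ and $|T_n'(x)-T_n'(y)|\le K_1|x-y|$; 2. $c\,\delta_0\le|W_n|\le\delta_0$; 3. $T_n(W_n)\cap W_{n-1}=\emptyset$ and $T_{n-1}(T_n(W_n))\cap W_n=\emptyset$; 4. $\big(T_{n+k-1}\circ\cdots\circ T_n\circ T_{n-1}\circ T_n\big)(W_n)\cap W_{n+k}=\emptyset$ for all $1\le k\le N$. The dynamical random walk is the map $F(x,z)=(T_zx,\,z-1)$ if $x\in W_z$, $F(x,z)=(T_zx,\,z+1)$ if $x\notin W_z$, on $\mathbb{T}\times\mathbb{Z}$.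 Let $\tau_n(x,k)$ be the smallest $t\ge 0$ with $F^t(x,k)\in\mathbb{T}\times\{n\}$, and put $\tau_n(x)=\tau_n(x,0)$ and $r_n(x)=\tau_{n+1}(x,n)$. Let $G_n(x)$ be the $\mathbb{T}$-component of $F^{r_n(x)}(x,n)$, and let $G_{1,i}=G_i\circ\cdots\circ G_1$. For $n\ge0$ put $$\sigma_n^2=\int_{\mathbb{T}}\Big(\sum_{i=1}^n\Big[r_i(G_{1,i}(x))-\int_{\mathbb{T}}r_i(G_{1,i}(y))\,dy\Big]\Big)^2dx .$$ **Lemma.** Given $\gamma,K,K_1,c$ as above, there are $\bar\delta_0>0$ and $N_0\ge1$ such that for every $N\ge N_0$ and every $0<\delta_0\le\bar\delta_0$ there is a constant $C>0$ (depending only on $\gamma,K,K_1,c,\delta_0,N$) such that for every Model A$'$ with parameters $(\gamma,K,K_1,c,\delta_0,N)$ and every $n\ge0$, $$\sigma_n^2\ge Cn\qquad\text{and}\qquad \operatorname{Var}(\tau_n)\ge Cn,$$ where the variance of the hitting time $\tau_n(x)$ is taken with $x$ uniformly distributed on $\mathbb{T}$. -/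

import Mathlib

open MeasureTheory ProbabilityTheory

noncomputable section

namespace DRW

/-- The circle `𝕋 = ℝ / ℤ`; `volume` on it is Lebesgue measure of total mass one, that is,
the uniform distribution. -/
abbrev Torus : Type := UnitAddCircle

/-- `compFrom S n k` is the composition `S (n + k - 1) ∘ ⋯ ∘ S (n + 1) ∘ S n` of `k` maps
(the identity for `k = 0`). -/
def compFrom (S : ℤ → Torus → Torus) (n : ℤ) : ℕ → Torus → Torus
  | 0 => id
  | k + 1 => S (n + (k : ℤ)) ∘ compFrom S n k

/-- `T : 𝕋 → 𝕋` is of class `C^{1+Lip}`, with `γ ≤ |T'| ≤ K` everywhere and with `T'` Lipschitz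
with constant `K₁`. The derivative is read off a differentiable lift `f : ℝ → ℝ` of `T`. Since
`f (x + 1) - f x` is an integer that does not depend on `x`, the function `f'` is `1`-periodic, so
the Lipschitz bound on `ℝ` is the same as the one for the distance of the circle. -/
def IsExpanding (γ K K₁ : ℝ) (T : Torus → Torus) : Prop :=
  ∃ f f' : ℝ → ℝ,
    (∀ x : ℝ, ((f x : ℝ) : Torus) = T (x : Torus)) ∧
    (∀ x : ℝ, HasDerivAt f (f' x) x) ∧
    (∀ x : ℝ, γ ≤ |f' x| ∧ |f' x| ≤ K) ∧
    (∀ x y : ℝ, |f' x - f' y| ≤ K₁ * |x - y|)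

/-- An arc of the circle: the image of an interval of `ℝ` (open, closed or half-open). -/
def IsArc (W : Set Torus) : Prop :=
  ∃ I : Set ℝ, I.OrdConnected ∧ W = (fun x : ℝ => (x : Torus)) '' I

/-- Model A: uniformly expanding maps `T n` and small backward gates `W n` (the forward gate at `n`
is the complement of `W n`), such that after a step backward from `n` the next two steps are
forward. -/
structure ModelA (γ K K₁ c δ₀ : ℝ) (T : ℤ → Torus → Torus) (W : ℤ → Set Torus) : Prop where
  expanding : ∀ n, IsExpanding γ K K₁ (T n)
  arc : ∀ n, IsArc (W n)
  gate_lower : ∀ n, c * δ₀ ≤ volume.real (W n)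
  gate_upper : ∀ n, volume.real (W n) ≤ δ₀
  forward_one : ∀ n, (T n '' W n) ∩ W (n - 1) = ∅
  forward_two : ∀ n, (T (n - 1) '' (T n '' W n)) ∩ W n = ∅

/-- Model A′: Model A together with the separation of the gates up to order `N`,
`(T (n+k-1) ∘ ⋯ ∘ T n ∘ T (n-1) ∘ T n) (W n) ∩ W (n+k) = ∅` for `1 ≤ k ≤ N`. -/
structure ModelA' (γ K K₁ c δ₀ : ℝ) (N : ℕ) (T : ℤ → Torus → Torus) (W : ℤ → Set Torus) : Prop
    extends ModelA γ K K₁ c δ₀ T W where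
  separation : ∀ (n : ℤ) (k : ℕ), 1 ≤ k → k ≤ N →
    (compFrom T n k '' (T (n - 1) '' (T n '' W n))) ∩ W (n + (k : ℤ)) = ∅

open Classical in
/-- The dynamical random walk `F` on `𝕋 × ℤ`: at site `z` the internal state `x` becomes `T z x`,
and the walker moves to `z - 1` if `x ∈ W z` and to `z + 1` if `x ∉ W z`. -/
def walk (T : ℤ → Torus → Torus) (W : ℤ → Set Torus) (p : Torus × ℤ) : Torus × ℤ :=
  (T p.2 p.1, if p.1 ∈ W p.2 then p.2 - 1 else p.2 + 1)

/-- The smallest time `t` at which the walk started from `(x, k)` is at site `n`. -/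
def hittingTime (T : ℤ → Torus → Torus) (W : ℤ → Set Torus) (n : ℤ) (x : Torus) (k : ℤ) : ℕ :=
  sInf {t : ℕ | ((walk T W)^[t] (x, k)).2 = n}

/-- The time `r n` needed to pass from site `n` to site `n + 1`. -/
def passageTime (T : ℤ → Torus → Torus) (W : ℤ → Set Torus) (n : ℤ) (x : Torus) : ℕ :=
  hittingTime T W (n + 1) x n

/-- The induced map `G n`: the internal state upon the first arrival at `n + 1` from `n`. -/
def inducedMap (T : ℤ → Torus → Torus) (W : ℤ → Set Torus) (n : ℤ) (x : Torus) : Torus :=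
  ((walk T W)^[passageTime T W n x] (x, n)).1

/-- The variance of `∑ i ∈ {1, …, n}, r i (G i ∘ ⋯ ∘ G 1)`, with respect to Lebesgue measure. -/
def sigmaSq (T : ℤ → Torus → Torus) (W : ℤ → Set Torus) (n : ℕ) : ℝ :=
  ∫ x : Torus, (∑ i ∈ Finset.Icc 1 n,
    ((passageTime T W i (compFrom (inducedMap T W) 1 i x) : ℝ) -
      ∫ y : Torus, (passageTime T W i (compFrom (inducedMap T W) 1 i y) : ℝ))) ^ 2

end DRW

end

open MeasureTheory ProbabilityTheory

noncomputable section

namespace DRW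

/-! ### Functions of bounded variation on the circle -/

/-! A passage from `n` to `n + 1` takes three steps if it starts in the gate and one step otherwise,
so the passage time is `1 + 2 * 1_{W n}`. Both variances are therefore four times the variance of a
number of visits to arcs of measure comparable to δ = δ₀, under a sequential composition of the maps
`G n`.

Let `X i` be the indicator of the `i`-th visit and `p i` its mean. The densities of the state are
bounded above and below, so `p i` is comparable to δ and the diagonal terms `p i - p i ^ 2` are at
least a constant times δ. Off the diagonal only lower bounds on covariances are needed, and there
are two. Trivially, Cov ≥ `-p i * p j` ≥ -const·δ². Decay of correlations gives Cov ≥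
-const·μ^|i-j|·δ. The geometric mean of the two is const·δ^(3/2)·μ^(|i-j|/2), and its sum over `j`
is O(δ^(3/2)), which the diagonal dominates once δ is small (`exists_variance_lower_bound`).

This needs decay constants that do not depend on δ (`exists_decay`), which rest on two facts. First,
`G n` is `T n` off the gate and a composition of three maps on it. Restricting a function to the
gate or its complement at most doubles its variation, up to an L¹ term, so a Lasota-Yorke inequality
holds with rate 2/γ + 2/γ³ < 1 (`exists_transfer_piecewise`). Second, a density of controlled
variation is large on some interval. A gate of length at most δ leaves almost half of that interval
free, the expansion more than makes up for this loss, and after boundedly many steps the lower bound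
holds on the whole circle (`exists_uniform_lower_bound`). Applied to the positive and negative parts
of a mean-zero function, this shrinks its L¹ norm. -/

lemma eVariationOn_le_ofReal_iff {f : ℝ → ℝ} {s : Set ℝ} {v : ℝ} (hv : 0 ≤ v) :
    eVariationOn f s ≤ ENNReal.ofReal v ↔
      ∀ (n : ℕ) (u : ℕ → ℝ), Monotone u → (∀ i, u i ∈ s) →
        ∑ i ∈ Finset.range n, |f (u (i + 1)) - f (u i)| ≤ v := by
  have key : ∀ (n : ℕ) (u : ℕ → ℝ),
      ∑ i ∈ Finset.range n, edist (f (u (i + 1))) (f (u i)) =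
        ENNReal.ofReal (∑ i ∈ Finset.range n, |f (u (i + 1)) - f (u i)|) := by
    intro n u
    rw [ENNReal.ofReal_sum_of_nonneg fun i _ => abs_nonneg _]
    exact Finset.sum_congr rfl fun i _ => by rw [edist_dist, Real.dist_eq]
  constructor
  · intro h n u hu hus
    have := (eVariationOn.sum_le (f := f) (n := n) hu hus).trans h
    rwa [key, ENNReal.ofReal_le_ofReal_iff hv] at this
  · intro h
    refine iSup_le fun ⟨n, u, hu, hus⟩ => ?_
    change ∑ i ∈ Finset.range n, edist (f (u (i + 1))) (f (u i)) ≤ _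
    rw [key]
    exact ENNReal.ofReal_le_ofReal (h n u hu hus)

lemma eVariationOn_add_right (f : ℝ → ℝ) (a b c : ℝ) :
    eVariationOn (fun x => f (x + c)) (Set.Icc a b) =
      eVariationOn f (Set.Icc (a + c) (b + c)) := by
  have := eVariationOn.comp_eq_of_monotoneOn f (t := Set.Icc a b) (fun x => x + c)
    (fun x _ y _ h => by simpa using h)
  simpa [Function.comp_def, Set.image_add_const_Icc] using this

lemma eVariationOn_Icc_add_Icc (f : ℝ → ℝ) {a b c : ℝ} (hab : a ≤ b) (hbc : b ≤ c) :
    eVariationOn f (Set.Icc a b) + eVariationOn f (Set.Icc b c) =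
      eVariationOn f (Set.Icc a c) := by
  simpa using eVariationOn.Icc_add_Icc f (s := Set.univ) hab hbc (Set.mem_univ b)

/-- The variation of a periodic function over a period does not depend on the period. -/
lemma eVariationOn_period {f : ℝ → ℝ} (hf : Function.Periodic f 1) (a : ℝ) :
    eVariationOn f (Set.Icc a (a + 1)) = eVariationOn f (Set.Icc 0 1) := by
  have shift : ∀ (k : ℤ) (a b : ℝ),
      eVariationOn f (Set.Icc (a + k) (b + k)) = eVariationOn f (Set.Icc a b) := by
    intro k a b
    rw [← eVariationOn_add_right]
    congr 1
    funext x
    simpa using hf.int_mul k x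
  have h1 : a = Int.fract a + (⌊a⌋ : ℤ) := (Int.fract_add_floor a).symm
  have h2 : eVariationOn f (Set.Icc a (a + 1)) =
      eVariationOn f (Set.Icc (Int.fract a) (Int.fract a + 1)) := by
    rw [← shift ⌊a⌋ (Int.fract a) (Int.fract a + 1)]
    congr 2
    linarith
  have h3 := Int.fract_nonneg a
  have h4 := (Int.fract_lt_one a).le
  rw [h2, ← eVariationOn_Icc_add_Icc f h4 (by linarith : (1 : ℝ) ≤ Int.fract a + 1),
    ← eVariationOn_Icc_add_Icc f h3 h4]
  have h5 := shift 1 0 (Int.fract a)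
  simp only [Int.cast_one, zero_add] at h5
  rw [h5, add_comm]

lemma periodic_coe (h : Torus → ℝ) : Function.Periodic (fun t : ℝ => h t) 1 := by
  intro t
  simp

lemma measurable_of_comp_coe {α : Type*} [MeasurableSpace α] {h : Torus → α}
    (H : Measurable fun t : ℝ => h t) : Measurable h := by
  have h1 : h = (fun t : Set.Ioc (0 : ℝ) (0 + 1) => h ((t : ℝ) : Torus)) ∘
      AddCircle.measurableEquivIoc 1 0 := by
    funext x
    simp only [Function.comp]
    congr 1
    exact ((AddCircle.equivIoc 1 0).symm_apply_apply x).symm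
  rw [h1]
  exact (H.comp measurable_subtype_coe).comp (AddCircle.measurableEquivIoc 1 0).measurable

/-- `h` is a measurable function on the circle of total variation at most `v`. -/
structure BVBound (h : Torus → ℝ) (v : ℝ) : Prop where
  measurable : Measurable h
  nonneg : 0 ≤ v
  le : eVariationOn (fun t : ℝ => h t) (Set.Icc 0 1) ≤ ENNReal.ofReal v

namespace BVBound

variable {h g : Torus → ℝ} {v w : ℝ}

lemma le_period (H : BVBound h v) (a : ℝ) :
    eVariationOn (fun t : ℝ => h t) (Set.Icc a (a + 1)) ≤ ENNReal.ofReal v := by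
  rw [eVariationOn_period (periodic_coe h)]
  exact H.le

lemma of_period (hm : Measurable h) (hv : 0 ≤ v) (a : ℝ)
    (H : eVariationOn (fun t : ℝ => h t) (Set.Icc a (a + 1)) ≤ ENNReal.ofReal v) :
    BVBound h v :=
  ⟨hm, hv, by rwa [eVariationOn_period (periodic_coe h)] at H⟩

lemma sum_le (H : BVBound h v) (n : ℕ) (u : ℕ → ℝ) (hu : Monotone u)
    (hus : ∀ i, u i ∈ Set.Icc (0 : ℝ) 1) :
    ∑ i ∈ Finset.range n, |h (u (i + 1)) - h (u i)| ≤ v :=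
  (eVariationOn_le_ofReal_iff H.nonneg).1 H.le n u hu hus

lemma of_sum_le (hm : Measurable h) (hv : 0 ≤ v)
    (H : ∀ (n : ℕ) (u : ℕ → ℝ), Monotone u → (∀ i, u i ∈ Set.Icc (0 : ℝ) 1) →
        ∑ i ∈ Finset.range n, |h (u (i + 1)) - h (u i)| ≤ v) : BVBound h v :=
  ⟨hm, hv, (eVariationOn_le_ofReal_iff hv).2 H⟩

lemma mono (H : BVBound h v) (hvw : v ≤ w) : BVBound h w :=
  ⟨H.measurable, H.nonneg.trans hvw, H.le.trans (ENNReal.ofReal_le_ofReal hvw)⟩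

lemma const (c : ℝ) : BVBound (fun _ => c) 0 :=
  of_sum_le measurable_const le_rfl fun n u _ _ => by simp

lemma add (H : BVBound h v) (G : BVBound g w) : BVBound (h + g) (v + w) := by
  refine of_sum_le (H.measurable.add G.measurable) (add_nonneg H.nonneg G.nonneg) fun n u hu hus =>
    le_trans ?_ (add_le_add (H.sum_le n u hu hus) (G.sum_le n u hu hus))
  rw [← Finset.sum_add_distrib]
  refine Finset.sum_le_sum fun i _ => ?_
  simp only [Pi.add_apply]
  rw [add_sub_add_comm]
  exact abs_add_le _ _

lemma smul (H : BVBound h v) (c : ℝ) : BVBound (c • h) (|c| * v) := by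
  refine of_sum_le (H.measurable.const_smul c) (mul_nonneg (abs_nonneg _) H.nonneg)
    fun n u hu hus => le_trans (le_of_eq ?_)
      (mul_le_mul_of_nonneg_left (H.sum_le n u hu hus) (abs_nonneg c))
  rw [Finset.mul_sum]
  refine Finset.sum_congr rfl fun i _ => ?_
  rw [← abs_mul, mul_sub]
  rfl

lemma sub (H : BVBound h v) (G : BVBound g w) : BVBound (h - g) (v + w) := by
  have := H.add (G.smul (-1))
  simpa [sub_eq_add_neg] using this

lemma mul {a b : ℝ} (H : BVBound h v) (G : BVBound g w) (ha : ∀ x, |h x| ≤ a)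
    (hb : ∀ x, |g x| ≤ b) : BVBound (h * g) (b * v + a * w) := by
  have ha0 : 0 ≤ a := (abs_nonneg _).trans (ha 0)
  have hb0 : 0 ≤ b := (abs_nonneg _).trans (hb 0)
  refine of_sum_le (H.measurable.mul G.measurable)
    (add_nonneg (mul_nonneg hb0 H.nonneg) (mul_nonneg ha0 G.nonneg)) fun n u hu hus => ?_
  refine le_trans ?_ (add_le_add (mul_le_mul_of_nonneg_left (H.sum_le n u hu hus) hb0)
    (mul_le_mul_of_nonneg_left (G.sum_le n u hu hus) ha0))
  rw [Finset.mul_sum, Finset.mul_sum, ← Finset.sum_add_distrib]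
  refine Finset.sum_le_sum fun i _ => ?_
  simp only [Pi.mul_apply]
  have : h (u (i + 1)) * g (u (i + 1)) - h (u i) * g (u i) =
      g (u (i + 1)) * (h (u (i + 1)) - h (u i)) + h (u i) * (g (u (i + 1)) - g (u i)) := by ring
  rw [this]
  refine (abs_add_le _ _).trans (add_le_add ?_ ?_)
  · rw [abs_mul]
    exact mul_le_mul_of_nonneg_right (hb _) (abs_nonneg _)
  · rw [abs_mul]
    exact mul_le_mul_of_nonneg_right (ha _) (abs_nonneg _)

lemma posPart (H : BVBound h v) : BVBound (fun x => max (h x) 0) v := by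
  refine of_sum_le (H.measurable.max measurable_const) H.nonneg fun n u hu hus =>
    le_trans (Finset.sum_le_sum fun i _ => ?_) (H.sum_le n u hu hus)
  exact abs_max_sub_max_le_abs _ _ _

/-- Going once around the circle passes from `x` to `y` and back, so the oscillation is counted
twice. The resulting sup bound `v / 2 + ∫ |h|` makes a cut-off cost a factor 2 in variation. With
`v` in place of `v / 2` it would cost 3, and 3/γ + 3/γ³ need not be less than one for γ > 3. -/
lemma two_mul_abs_sub_le (H : BVBound h v) (x y : Torus) : 2 * |h x - h y| ≤ v := by
  obtain ⟨a, rfl⟩ := QuotientAddGroup.mk_surjective x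
  obtain ⟨b, hb, rfl⟩ : ∃ b ∈ Set.Ico a (a + 1), ((b : ℝ) : Torus) = y :=
    ⟨(AddCircle.equivIco 1 a y : ℝ), (AddCircle.equivIco 1 a y).2,
      (AddCircle.equivIco 1 a).symm_apply_apply y⟩
  have h1 := (eVariationOn_Icc_add_Icc (fun t : ℝ => h t) hb.1 hb.2.le).le.trans (H.le_period a)
  have h2 := (add_le_add
    (eVariationOn.edist_le (fun t : ℝ => h t) (Set.left_mem_Icc.2 hb.1) (Set.right_mem_Icc.2 hb.1))
    (eVariationOn.edist_le (fun t : ℝ => h t) (Set.right_mem_Icc.2 hb.2.le)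
      (Set.left_mem_Icc.2 hb.2.le))).trans h1
  have h3 : h ((a + 1 : ℝ) : Torus) = h (a : Torus) := periodic_coe h a
  rw [h3, edist_dist, ← ENNReal.ofReal_add dist_nonneg dist_nonneg,
    ENNReal.ofReal_le_ofReal_iff H.nonneg, Real.dist_eq] at h2
  rw [two_mul]
  exact h2

lemma abs_le_abs_add (H : BVBound h v) (x y : Torus) : |h x| ≤ |h y| + v / 2 := by
  have := H.two_mul_abs_sub_le x y
  have := abs_sub_abs_le_abs_sub (h x) (h y)
  linarith

end BVBound

lemma integrable_of_abs_le {h : Torus → ℝ} {a : ℝ} (hm : Measurable h) (ha : ∀ x, |h x| ≤ a) :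
    Integrable h :=
  Integrable.of_bound hm.aestronglyMeasurable a (Filter.Eventually.of_forall ha)

namespace BVBound

variable {h g : Torus → ℝ} {v w : ℝ}

lemma integrable (H : BVBound h v) : Integrable h :=
  integrable_of_abs_le H.measurable fun x => H.abs_le_abs_add x 0

lemma abs_le (H : BVBound h v) (x : Torus) : |h x| ≤ v / 2 + ∫ y, |h y| := by
  have h1 : ∫ _ : Torus, |h x| ≤ ∫ y, (|h y| + v / 2) :=
    integral_mono (integrable_const _) (H.integrable.abs.add (integrable_const _))
      fun y => H.abs_le_abs_add x y
  rw [integral_add H.integrable.abs (integrable_const _)] at h1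
  simp only [integral_const, smul_eq_mul, measureReal_def, UnitAddCircle.measure_univ,
    ENNReal.toReal_one, one_mul] at h1
  linarith

lemma integral_abs_nonneg (h : Torus → ℝ) : 0 ≤ ∫ y, |h y| :=
  integral_nonneg fun _ => abs_nonneg _

end BVBound

lemma coe_add_intCast (a : ℝ) (k : ℤ) : ((a + k : ℝ) : Torus) = a := by
  have : ((k : ℝ) : Torus) = 0 := (AddCircle.coe_eq_zero_iff 1).2 ⟨k, by simp⟩
  rw [AddCircle.coe_add, this, add_zero]

/-! ### Arcs -/

/-- An arc of measure less than one is the injective image of an interval. -/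
lemma IsArc.exists_interval {W : Set Torus} (hW : IsArc W) (h1 : volume.real W < 1) :
    ∃ (a : ℝ) (J : Set ℝ), J ⊆ Set.Ioo a (a + 1) ∧ J.OrdConnected ∧
      ∀ t ∈ Set.Icc a (a + 1), ((t : Torus) ∈ W ↔ t ∈ J) := by
  obtain ⟨I, hI, rfl⟩ := hW
  have hne : ∃ p : Torus, p ∉ (fun x : ℝ => (x : Torus)) '' I := by
    by_contra hcon
    push Not at hcon
    rw [Set.eq_univ_of_forall hcon, measureReal_def, UnitAddCircle.measure_univ] at h1
    simp at h1
  obtain ⟨p, hp⟩ := hne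
  obtain ⟨a, rfl⟩ := QuotientAddGroup.mk_surjective p
  -- `I` avoids every integer translate of a lift of the omitted point `p`, so by connectedness it
  -- lies between two consecutive ones.
  have hout : ∀ k : ℤ, a + k ∉ I := by
    intro k hk
    apply hp
    exact ⟨a + k, hk, coe_add_intCast a k⟩
  have hfl : ∀ i ∈ I, ∀ j ∈ I, ⌊i - a⌋ ≤ ⌊j - a⌋ := by
    intro i hi j hj
    by_contra hlt
    push Not at hlt
    have e1 : (⌊i - a⌋ : ℝ) ≤ i - a := Int.floor_le _
    have e2 : j - a < (⌊i - a⌋ : ℝ) := Int.floor_lt.1 hlt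
    exact hout ⌊i - a⌋ (hI.out hj hi ⟨by linarith, by linarith⟩)
  rcases I.eq_empty_or_nonempty with rfl | ⟨i₀, hi₀⟩
  · exact ⟨a, ∅, by simp, Set.ordConnected_empty, by simp⟩
  set m : ℤ := ⌊i₀ - a⌋ with hm
  have hloc : ∀ i ∈ I, a + m < i ∧ i < a + m + 1 := by
    intro i hi
    have e : ⌊i - a⌋ = m := le_antisymm (hfl i hi i₀ hi₀) (hfl i₀ hi₀ i hi)
    have e1 : (⌊i - a⌋ : ℝ) ≤ i - a := Int.floor_le _
    have e2 : i - a < ⌊i - a⌋ + 1 := Int.lt_floor_add_one _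
    rw [e] at e1 e2
    refine ⟨lt_of_le_of_ne (by linarith) ?_, by linarith⟩
    rintro rfl
    exact hout m hi
  refine ⟨a, (fun t => t + m) ⁻¹' I, ?_, ?_, ?_⟩
  · intro t ht
    have := hloc _ ht
    exact ⟨by linarith, by linarith⟩
  · exact ⟨fun x hx y hy z hz => hI.out hx hy ⟨by linarith [hz.1], by linarith [hz.2]⟩⟩
  · intro t ht
    constructor
    · rintro ⟨i, hi, hit⟩
      have h2 : ((i - t : ℝ) : Torus) = 0 := by
        rw [AddCircle.coe_sub, sub_eq_zero]
        exact hit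
      obtain ⟨k, hk⟩ := (AddCircle.coe_eq_zero_iff 1).1 h2
      have hk' : (k : ℝ) = i - t := by simpa using hk
      have h3 := hloc i hi
      have e : k = m := by
        have e1 : k < m + 1 := by
          have : (k : ℝ) < m + 1 := by linarith [ht.1]
          exact_mod_cast this
        have e2 : m - 1 < k := by
          have : (m : ℝ) - 1 < k := by linarith [ht.2]
          exact_mod_cast this
        omega
      rw [e] at hk'
      have : i = t + m := by linarith
      simpa [← this] using hi
    · intro h2
      exact ⟨t + m, h2, coe_add_intCast t m⟩

lemma IsArc.measurableSet {W : Set Torus} (hW : IsArc W) (h1 : volume.real W < 1) :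
    MeasurableSet W := by
  classical
  obtain ⟨a, J, hJ, hJc, hJW⟩ := hW.exists_interval h1
  have h2 : W = (AddCircle.measurableEquivIoc 1 a) ⁻¹' (Subtype.val ⁻¹' J) := by
    ext x
    have h3 : (((AddCircle.measurableEquivIoc 1 a x : Set.Ioc a (a + 1)) : ℝ) : Torus) = x :=
      (AddCircle.equivIoc 1 a).symm_apply_apply x
    have h4 := (AddCircle.measurableEquivIoc 1 a x).2
    have := hJW _ ⟨h4.1.le, h4.2⟩
    rw [h3] at this
    exact this
  rw [h2]
  exact (AddCircle.measurableEquivIoc 1 a).measurable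
    (measurable_subtype_coe hJc.measurableSet)

/-- The indicator function of an arc has variation at most two. -/
lemma IsArc.bvBound_indicator {W : Set Torus} (hW : IsArc W) (h1 : volume.real W < 1) :
    BVBound (W.indicator 1) 2 := by
  classical
  obtain ⟨a, J, hJ, hJc, hJW⟩ := hW.exists_interval h1
  refine BVBound.of_period (measurable_one.indicator (hW.measurableSet h1)) (by norm_num) a ?_
  rw [eVariationOn_le_ofReal_iff (by norm_num)]
  intro n u hu hus
  have hcond : ∀ i j k, i ≤ j → j ≤ k → u i ∈ J → u k ∈ J → u j ∈ J := fun i j k hij hjk hi hk =>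
    hJc.out hi hk ⟨hu hij, hu hjk⟩
  have hval : ∀ i, W.indicator (1 : Torus → ℝ) (u i) = if u i ∈ J then 1 else 0 := by
    intro i
    rw [Set.indicator_apply]
    simp [hJW _ (hus i)]
  simp only [hval]
  -- The three values record the position of `u m`: not yet in `J`, inside `J`, already past `J`.
  -- Order-connectedness of `J` forbids a return.
  have hstep : ∀ m, (∑ i ∈ Finset.range m,
      |(if u (i + 1) ∈ J then (1 : ℝ) else 0) - if u i ∈ J then 1 else 0|) ≤
      if u m ∈ J then 1 else if ∃ i < m, u i ∈ J then 2 else 0 := by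
    intro m
    induction m with
    | zero => simp; split_ifs <;> norm_num
    | succ m ih =>
      rw [Finset.sum_range_succ]
      refine (add_le_add_left ih _).trans ?_
      by_cases hm : u m ∈ J
      · by_cases hm1 : u (m + 1) ∈ J
        · simp [hm, hm1]
        · have : ∃ i < m + 1, u i ∈ J := ⟨m, by omega, hm⟩
          simp only [hm, hm1, this, if_true, if_false]
          norm_num
      · by_cases hm1 : u (m + 1) ∈ J
        · have hno : ¬ ∃ i < m, u i ∈ J := by
            rintro ⟨i, hi, hiJ⟩
            exact hm (hcond i m (m + 1) hi.le (by omega) hiJ hm1)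
          simp [hm, hm1, hno]
        · by_cases hex : ∃ i < m, u i ∈ J
          · have : ∃ i < m + 1, u i ∈ J := by
              obtain ⟨i, hi, hiJ⟩ := hex
              exact ⟨i, by omega, hiJ⟩
            simp only [hm, hm1, hex, this, if_true, if_false]
            simp
          · simp only [hm, hm1, hex, if_false]
            simp
            split_ifs <;> norm_num
  refine (hstep n).trans ?_
  split_ifs <;> norm_num

/-- Two points of the line at distance less than `1 - |W|` which project to an arc `W` are at
distance at most `|W|`. -/
lemma IsArc.abs_sub_le {W : Set Torus} (hW : IsArc W) {s t : ℝ} (hs : (s : Torus) ∈ W)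
    (ht : (t : Torus) ∈ W) (hst : |s - t| + volume.real W < 1) : |s - t| ≤ volume.real W := by
  have h1 : volume.real W < 1 := by linarith [abs_nonneg (s - t)]
  obtain ⟨a, J, hJ, hJc, hJW⟩ := hW.exists_interval h1
  have hlen : ∀ x ∈ J, ∀ y ∈ J, y - x ≤ volume.real W := by
    intro x hx y hy
    have h2 := AddCircle.add_projection_respects_measure (T := 1) a (hW.measurableSet h1)
    have h3 : Set.Icc x y ⊆ QuotientAddGroup.mk ⁻¹' W ∩ Set.Ioc a (a + 1) := by
      intro z hz
      have hzJ := hJc.out hx hy hz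
      have hz2 := hJ hzJ
      exact ⟨(hJW z ⟨hz2.1.le, hz2.2.le⟩).2 hzJ, hz2.1, hz2.2.le⟩
    have h4 := measure_mono (μ := volume) h3
    rw [← h2, Real.volume_Icc] at h4
    exact (ENNReal.ofReal_le_iff_le_toReal (measure_ne_top _ _)).1 h4
  have hmem : ∀ s : ℝ, (s : Torus) ∈ W → s - ⌊s - a⌋ ∈ J := by
    intro s hs
    have e1 : (⌊s - a⌋ : ℝ) ≤ s - a := Int.floor_le _
    have e2 : s - a < ⌊s - a⌋ + 1 := Int.lt_floor_add_one _
    refine (hJW _ ⟨by linarith, by linarith⟩).1 ?_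
    have : ((⌊s - a⌋ : ℝ) : Torus) = 0 := (AddCircle.coe_eq_zero_iff 1).2 ⟨⌊s - a⌋, by simp⟩
    rw [AddCircle.coe_sub, this, sub_zero]
    exact hs
  have e1 := hlen _ (hmem s hs) _ (hmem t ht)
  have e2 := hlen _ (hmem t ht) _ (hmem s hs)
  have e3 := abs_lt.1 (by linarith : |s - t| < 1 - volume.real W)
  -- The representatives in `J` differ by at most `|W|`, and `s`, `t` by less than `1 - |W|`, so the
  -- integer parts differ by less than one.
  have e4 : ⌊s - a⌋ = ⌊t - a⌋ := by
    have i1 : ⌊s - a⌋ - ⌊t - a⌋ < 1 := by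
      have : (⌊s - a⌋ : ℝ) - ⌊t - a⌋ < 1 := by linarith
      exact_mod_cast this
    have i2 : -1 < ⌊s - a⌋ - ⌊t - a⌋ := by
      have : (-1 : ℝ) < ⌊s - a⌋ - ⌊t - a⌋ := by linarith
      exact_mod_cast this
    omega
  rw [e4] at e1 e2
  rw [_root_.abs_le]
  constructor <;> linarith

instance : IsProbabilityMeasure (volume : Measure Torus) := ⟨UnitAddCircle.measure_univ⟩

/-! ### Transfer operators of expanding maps -/

/-- `L` is a transfer operator of `S`, which satisfies a Lasota-Yorke inequality. -/
structure IsTransfer (S : Torus → Torus) (α D : ℝ) (L : (Torus → ℝ) →ₗ[ℝ] (Torus → ℝ)) :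
    Prop where
  nonneg : ∀ h : Torus → ℝ, (∀ x, 0 ≤ h x) → ∀ x, 0 ≤ L h x
  bv : ∀ (h : Torus → ℝ) (v : ℝ), BVBound h v → BVBound (L h) (α * v + D * ∫ x, |h x|)
  dual : ∀ (h : Torus → ℝ) (v : ℝ) (g : Torus → ℝ) (a : ℝ), BVBound h v → Measurable g →
    (∀ x, |g x| ≤ a) → ∫ x, L h x * g x = ∫ x, h x * g (S x)

lemma intervalIntegrable_of_bound {h : ℝ → ℝ} {a : ℝ} (hm : Measurable h) (ha : ∀ x, |h x| ≤ a)
    (p q : ℝ) : IntervalIntegrable h volume p q :=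
  (intervalIntegrable_const (c := a)).mono_fun' hm.aestronglyMeasurable
    (Filter.Eventually.of_forall ha)

/-- The variation of a product of a function of bounded variation and a Lipschitz function. -/
lemma eVariationOn_mul_lipschitz_le {h g : ℝ → ℝ} {a b v α Λ M : ℝ} (hab : a ≤ b) (hv : 0 ≤ v)
    (hm : Measurable h) (hM : ∀ x, |h x| ≤ M) (hα : ∀ x, |g x| ≤ α) (hΛ : 0 ≤ Λ)
    (hg : ∀ x y, |g x - g y| ≤ Λ * |x - y|)
    (H : eVariationOn h (Set.Icc a b) ≤ ENNReal.ofReal v) :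
    eVariationOn (fun x => h x * g x) (Set.Icc a b) ≤
      ENNReal.ofReal (α * v + Λ * ∫ x in a..b, |h x|) := by
  have hα0 : 0 ≤ α := (abs_nonneg _).trans (hα 0)
  have hi : ∀ p q, IntervalIntegrable (fun x => |h x|) volume p q := fun p q =>
    (intervalIntegrable_of_bound hm hM p q).abs
  have hI0 : ∀ p q, p ≤ q → 0 ≤ ∫ x in p..q, |h x| := fun p q hpq =>
    intervalIntegral.integral_nonneg hpq fun _ _ => abs_nonneg _
  rw [eVariationOn_le_ofReal_iff (by have := hI0 a b hab; positivity)]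
  intro n u hu hus
  have hfin : ∀ p q, a ≤ p → q ≤ b → eVariationOn h (Set.Icc p q) ≠ ⊤ := fun p q hp hq =>
    ne_top_of_le_ne_top ENNReal.ofReal_ne_top
      ((eVariationOn.mono h (Set.Icc_subset_Icc hp hq)).trans H)
  have hstep : ∀ i, |h (u (i + 1)) * g (u (i + 1)) - h (u i) * g (u i)| ≤
      α * (eVariationOn h (Set.Icc (u i) (u (i + 1)))).toReal +
        Λ * ∫ x in u i..u (i + 1), |h x| := by
    intro i
    have hle : u i ≤ u (i + 1) := hu (Nat.le_succ i)
    have hp := (hus i).1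
    have hq := (hus (i + 1)).2
    generalize u i = p at *
    generalize u (i + 1) = q at *
    rcases hle.eq_or_lt with rfl | hlt
    · simp only [sub_self, abs_zero, intervalIntegral.integral_same, mul_zero, add_zero]
      positivity
    -- At `z` the value of `|h|` is at most its average over `[p, q]`. Splitting the increment at
    -- `z` charges the oscillation of `h` to the variation and the oscillation of `g` to the
    -- integral.
    obtain ⟨z, hz, hzI⟩ : ∃ z ∈ Set.Icc p q, |h z| * (q - p) ≤ ∫ x in p..q, |h x| := by
      obtain ⟨z, hz, hzle⟩ := exists_le_setAverage (μ := volume) (s := Set.Ioc p q)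
        (f := fun x => |h x|) (by simp [hlt]) (by simp)
        ((intervalIntegrable_iff_integrableOn_Ioc_of_le hle).1 (hi p q))
      refine ⟨z, ⟨hz.1.le, hz.2⟩, ?_⟩
      rw [setAverage_eq, ← intervalIntegral.integral_of_le hle, Real.volume_real_Ioc_of_le hle,
        smul_eq_mul] at hzle
      calc |h z| * (q - p) ≤ ((q - p)⁻¹ * ∫ x in p..q, |h x|) * (q - p) :=
            mul_le_mul_of_nonneg_right hzle (by linarith)
        _ = _ := by field_simp [(sub_pos.2 hlt).ne']
    have hvar : |h q - h z| + |h z - h p| ≤ (eVariationOn h (Set.Icc p q)).toReal := by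
      have h1 := (add_le_add
        (eVariationOn.edist_le h (Set.right_mem_Icc.2 hz.1) (Set.left_mem_Icc.2 hz.1))
        (eVariationOn.edist_le h (Set.right_mem_Icc.2 hz.2) (Set.left_mem_Icc.2 hz.2))).trans
          (eVariationOn_Icc_add_Icc h hz.1 hz.2).le
      rw [edist_dist, edist_dist, ← ENNReal.ofReal_add dist_nonneg dist_nonneg,
        ENNReal.ofReal_le_iff_le_toReal (hfin p q hp hq), Real.dist_eq, Real.dist_eq] at h1
      linarith
    have hdec : h q * g q - h p * g p =
        ((h q - h z) * g q + (h z - h p) * g p) + h z * (g q - g p) := by ring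
    rw [hdec]
    have h1 : |(h q - h z) * g q| ≤ |h q - h z| * α := by
      rw [abs_mul]; exact mul_le_mul_of_nonneg_left (hα _) (abs_nonneg _)
    have h2 : |(h z - h p) * g p| ≤ |h z - h p| * α := by
      rw [abs_mul]; exact mul_le_mul_of_nonneg_left (hα _) (abs_nonneg _)
    have h3 : |h z * (g q - g p)| ≤ Λ * (|h z| * (q - p)) := by
      rw [abs_mul]
      have := mul_le_mul_of_nonneg_left (hg q p) (abs_nonneg (h z))
      rw [abs_of_pos (sub_pos.2 hlt)] at this
      linarith
    have h4 := mul_le_mul_of_nonneg_left hvar hα0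
    have h5 := mul_le_mul_of_nonneg_left hzI hΛ
    have h6 := abs_add_le ((h q - h z) * g q + (h z - h p) * g p) (h z * (g q - g p))
    have h7 := abs_add_le ((h q - h z) * g q) ((h z - h p) * g p)
    linarith
  refine (Finset.sum_le_sum fun i _ => hstep i).trans ?_
  rw [Finset.sum_add_distrib, ← Finset.mul_sum, ← Finset.mul_sum,
    intervalIntegral.sum_integral_adjacent_intervals fun i _ => hi _ _,
    ← ENNReal.toReal_sum fun i _ => hfin _ _ (hus i).1 (hus (i + 1)).2,
    eVariationOn.sum' h hu]
  refine add_le_add (mul_le_mul_of_nonneg_left ?_ hα0) (mul_le_mul_of_nonneg_left ?_ hΛ)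
  · refine ENNReal.toReal_le_of_le_ofReal hv ((eVariationOn.mono h ?_).trans H)
    exact Set.Icc_subset_Icc (hus 0).1 (hus n).2
  · exact intervalIntegral.integral_mono_interval (hus 0).1 (hu (Nat.zero_le n)) (hus n).2
      (Filter.Eventually.of_forall fun _ => abs_nonneg _) (hi a b)

/-! ### The transfer operator of a single expanding map -/

lemma sum_range_periodic {k : ℝ → ℝ} {d : ℕ} (hk : Function.Periodic k d) :
    Function.Periodic (fun t => ∑ j ∈ Finset.range d, k (t + j)) 1 := by
  intro t
  have h1 : ∀ j : ℕ, k (t + 1 + j) = k (t + (j + 1 : ℕ)) := fun j => by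
    congr 1; push_cast; ring
  simp only [h1]
  have h2 := Finset.sum_range_succ (fun j : ℕ => k (t + j)) d
  have h3 := Finset.sum_range_succ' (fun j : ℕ => k (t + j)) d
  have h4 := hk t
  simp only [Nat.cast_zero, add_zero] at h3
  linarith

/-- The increment of a lift over a period is constant. -/
lemma exists_degree {T : Torus → Torus} {f : ℝ → ℝ} (hf : ∀ x : ℝ, ((f x : ℝ) : Torus) = T x)
    (hc : Continuous f) : ∃ d : ℤ, ∀ x, f (x + 1) = f x + d := by
  have h1 : ∀ x, ∃ k : ℤ, (k : ℝ) = f (x + 1) - f x := by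
    intro x
    have : ((f (x + 1) - f x : ℝ) : Torus) = 0 := by
      rw [AddCircle.coe_sub, hf, hf, sub_eq_zero]
      simp
    obtain ⟨k, hk⟩ := (AddCircle.coe_eq_zero_iff 1).1 this
    exact ⟨k, by simpa using hk⟩
  choose k hk using h1
  have hkc : Continuous k := by
    rw [Int.isClosedEmbedding_coe_real.isEmbedding.continuous_iff]
    have : (Int.cast ∘ k : ℝ → ℝ) = fun x => f (x + 1) - f x := funext hk
    rw [this]
    fun_prop
  refine ⟨k 0, fun x => ?_⟩
  rw [← PreconnectedSpace.constant inferInstance hkc (x := x) (y := 0), hk]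
  ring

/-- On the line, `L h` at `t` is the sum of `(h / f') ∘ f⁻¹` over `t, t + 1, …, t + d - 1`, with `d`
the degree. As `t` runs over a unit interval, the preimages sweep out one period exactly once.
Variation and integral of `L h` are thus controlled by those of `h / f'` over one period, where `1 /
f'` is bounded by γ⁻¹ and Lipschitz with constant K₁γ⁻². -/
lemma exists_transfer_of_monotone {T : Torus → Torus} {f f' : ℝ → ℝ} {γ K K₁ : ℝ} (hγ : 0 < γ)
    (hf : ∀ x : ℝ, ((f x : ℝ) : Torus) = T x) (hd : ∀ x, HasDerivAt f (f' x) x)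
    (hlow : ∀ x, γ ≤ f' x) (hup : ∀ x, f' x ≤ K)
    (hlip : ∀ x y : ℝ, |f' x - f' y| ≤ K₁ * |x - y|) :
    ∃ L : (Torus → ℝ) →ₗ[ℝ] (Torus → ℝ), IsTransfer T γ⁻¹ (K₁ * (γ⁻¹ * γ⁻¹)) L ∧
      ∀ h : Torus → ℝ, (∀ x, 0 ≤ h x) → ∀ x, h x / K ≤ L h (T x) := by
  have hpos : ∀ x, 0 < f' x := fun x => hγ.trans_le (hlow x)
  have hderiv : ∀ x, deriv f x = f' x := fun x => (hd x).deriv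
  have hdiff : Differentiable ℝ f := fun x => (hd x).differentiableAt
  have hmono : StrictMono f := strictMono_of_deriv_pos fun x => by rw [hderiv]; exact hpos x
  have hgrow : ∀ ⦃x y : ℝ⦄, x ≤ y → γ * (y - x) ≤ f y - f x :=
    mul_sub_le_image_sub_of_le_deriv hdiff fun x => by rw [hderiv]; exact hlow x
  have hsurj : Function.Surjective f := by
    refine hdiff.continuous.surjective ?_ ?_
    · refine Filter.tendsto_atTop_mono' _ (f₁ := fun x => γ * x + f 0) ?_
        (Filter.tendsto_atTop_add_const_right _ _ (Filter.tendsto_id.const_mul_atTop hγ))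
      filter_upwards [Filter.eventually_ge_atTop 0] with x hx
      have := hgrow hx
      linarith
    · refine Filter.tendsto_atBot_mono' _ (f₁ := fun x => γ * x + f 0) ?_
        (Filter.tendsto_atBot_add_const_right _ _ (Filter.tendsto_id.const_mul_atBot hγ))
      filter_upwards [Filter.eventually_le_atBot 0] with x hx
      have := hgrow hx
      linarith
  have hK₁ : 0 ≤ K₁ := by
    have := (abs_nonneg _).trans (hlip 1 0)
    simpa using this
  have hf'c : Continuous f' := by
    have : LipschitzWith (Real.toNNReal K₁) f' := LipschitzWith.of_dist_le_mul fun x y => by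
      rw [Real.dist_eq, Real.dist_eq, Real.coe_toNNReal _ hK₁]
      exact hlip x y
    exact this.continuous
  obtain ⟨D, hD⟩ := exists_degree hf hdiff.continuous
  have hDpos : 0 < D := by
    have h1 := hgrow (by linarith : (0 : ℝ) ≤ 0 + 1)
    rw [hD 0] at h1
    have : (0 : ℝ) < D := by linarith
    exact_mod_cast this
  obtain ⟨d, rfl⟩ := Int.eq_ofNat_of_zero_le hDpos.le
  have hD' : ∀ x, f (x + 1) = f x + d := by simpa using hD
  have hf'per : ∀ x, f' (x + 1) = f' x := by
    intro x
    have h1 : HasDerivAt (fun y => f (y + 1)) (f' (x + 1)) x := (hd (x + 1)).comp_add_const x 1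
    have h2 : HasDerivAt (fun y => f (y + 1)) (f' x) x := by
      have : (fun y => f (y + 1)) = fun y => f y + d := funext hD'
      rw [this]
      exact (hd x).add_const _
    exact h1.unique h2
  set e : ℝ ≃o ℝ := hmono.orderIsoOfSurjective f hsurj with he
  have hef : ∀ x, e x = f x := fun x => rfl
  have hfe : ∀ y, f (e.symm y) = y := fun y => e.apply_symm_apply y
  have hef' : ∀ x, e.symm (f x) = x := fun x => e.symm_apply_apply x
  have hφd : ∀ y, e.symm (y + d) = e.symm y + 1 := by
    intro y
    rw [e.symm_apply_eq, hef, hD', hfe]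
  have hφc : Continuous e.symm := e.symm.continuous
  set k : (Torus → ℝ) → ℝ → ℝ := fun h y => h (e.symm y : ℝ) * (f' (e.symm y))⁻¹ with hk
  have hkper : ∀ h, Function.Periodic (k h) d := by
    intro h y
    simp only [hk, hφd, hf'per]
    congr 1
    exact periodic_coe h _
  set L : (Torus → ℝ) →ₗ[ℝ] (Torus → ℝ) :=
    { toFun := fun h x => ∑ j ∈ Finset.range d, k h ((AddCircle.equivIco 1 0 x : ℝ) + j)
      map_add' := by
        intro h g
        funext x
        simp [hk, add_mul, Finset.sum_add_distrib]
      map_smul' := by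
        intro c h
        funext x
        simp [hk, mul_assoc, Finset.mul_sum] } with hL
  -- Since `k h` is `d`-periodic, the sum of its `d` translates is 1-periodic, and the
  -- representative used to define `L` is immaterial.
  have hLt : ∀ h (t : ℝ), L h t = ∑ j ∈ Finset.range d, k h (t + j) := by
    intro h t
    change ∑ j ∈ Finset.range d, k h ((AddCircle.equivIco 1 0 (t : Torus) : ℝ) + j) = _
    rw [AddCircle.coe_equivIco_mk_apply]
    have h1 := (sum_range_periodic (hkper h)).sub_zsmul_eq ⌊t⌋ (x := t)
    simp only [div_one, mul_one]
    rw [← Int.self_sub_floor]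
    simpa using h1
  have hinv0 : ∀ x, 0 ≤ (f' x)⁻¹ := fun x => inv_nonneg.2 (hpos x).le
  have hinv : ∀ x, |(f' x)⁻¹| ≤ γ⁻¹ := fun x => by
    rw [abs_of_nonneg (hinv0 x)]
    exact inv_anti₀ hγ (hlow x)
  have hinvlip : ∀ x y, |(f' x)⁻¹ - (f' y)⁻¹| ≤ K₁ * (γ⁻¹ * γ⁻¹) * |x - y| := by
    intro x y
    have h1 : (f' x)⁻¹ - (f' y)⁻¹ = ((f' x)⁻¹ * (f' y)⁻¹) * (f' y - f' x) := by
      field_simp [(hpos x).ne', (hpos y).ne']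
    rw [h1, abs_mul, abs_mul]
    have h2 := mul_le_mul (hinv x) (hinv y) (abs_nonneg _) (inv_nonneg.2 hγ.le)
    have h3 := hlip y x
    rw [abs_sub_comm y x] at h3
    calc _ ≤ (γ⁻¹ * γ⁻¹) * (K₁ * |x - y|) :=
          mul_le_mul h2 h3 (abs_nonneg _) (by positivity)
      _ = _ := by ring
  have hkm : ∀ h, Measurable h → Measurable (k h) := by
    intro h hm
    exact (hm.comp (AddCircle.measurable_mk'.comp hφc.measurable)).mul
      (hf'c.comp hφc).measurable.inv
  have hLm : ∀ h, Measurable h → Measurable (L h) := by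
    intro h hm
    refine measurable_of_comp_coe ?_
    simp only [hLt]
    exact Finset.measurable_sum _ fun j _ => (hkm h hm).comp (measurable_id.add_const _)
  refine ⟨L, ⟨?_, ?_, ?_⟩, ?_⟩
  · intro h h0 x
    obtain ⟨t, rfl⟩ := QuotientAddGroup.mk_surjective x
    rw [hLt]
    exact Finset.sum_nonneg fun j _ => mul_nonneg (h0 _) (hinv0 _)
  · intro h v H
    have hI := BVBound.integral_abs_nonneg h
    have hv0 := H.nonneg
    have hbd0 : 0 ≤ γ⁻¹ * v + K₁ * (γ⁻¹ * γ⁻¹) * ∫ x, |h x| := by positivity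
    refine BVBound.of_sum_le (hLm h H.measurable) hbd0 ?_
    have hvar : eVariationOn (k h) (Set.Icc 0 d) ≤
        ENNReal.ofReal (γ⁻¹ * v + K₁ * (γ⁻¹ * γ⁻¹) * ∫ x, |h x|) := by
      have h1 := eVariationOn_mul_lipschitz_le (h := fun t : ℝ => h t) (g := fun t => (f' t)⁻¹)
        (by linarith : e.symm 0 ≤ e.symm 0 + 1) H.nonneg
        (H.measurable.comp AddCircle.measurable_mk') (fun x => H.abs_le x) hinv
        (by positivity) hinvlip (H.le_period _)
      rw [UnitAddCircle.intervalIntegral_preimage (e.symm 0) fun x => |h x|] at h1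
      refine le_trans ?_ h1
      refine eVariationOn.comp_le_of_monotoneOn (fun t : ℝ => h t * (f' t)⁻¹) e.symm
        (e.symm.monotone.monotoneOn _) ?_
      intro y hy
      refine ⟨e.symm.monotone hy.1, ?_⟩
      rw [← hφd, zero_add]
      exact e.symm.monotone hy.2
    intro n u hu hus
    have hsplit : ∑ j ∈ Finset.range d, eVariationOn (fun t => k h (t + j)) (Set.Icc 0 1) =
        eVariationOn (k h) (Set.Icc 0 d) := by
      have := eVariationOn.sum' (k h) (I := fun j : ℕ => (j : ℝ)) Nat.mono_cast (n := d)
      simp only [Nat.cast_zero] at this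
      rw [← this]
      refine Finset.sum_congr rfl fun j _ => ?_
      rw [eVariationOn_add_right]
      push_cast
      rw [zero_add, add_comm]
    have hfin : ∀ j ∈ Finset.range d,
        eVariationOn (fun t => k h (t + j)) (Set.Icc 0 1) ≠ ⊤ := by
      intro j hj
      refine ne_top_of_le_ne_top ENNReal.ofReal_ne_top ((le_trans ?_ hsplit.le).trans hvar)
      exact Finset.single_le_sum (f := fun j : ℕ =>
        eVariationOn (fun t => k h (t + j)) (Set.Icc (0 : ℝ) 1)) (fun _ _ => zero_le) hj
    calc ∑ i ∈ Finset.range n, |L h (u (i + 1)) - L h (u i)|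
        ≤ ∑ i ∈ Finset.range n, ∑ j ∈ Finset.range d, |k h (u (i + 1) + j) - k h (u i + j)| := by
          refine Finset.sum_le_sum fun i _ => ?_
          rw [hLt, hLt, ← Finset.sum_sub_distrib]
          exact Finset.abs_sum_le_sum_abs _ _
      _ = ∑ j ∈ Finset.range d, ∑ i ∈ Finset.range n, |k h (u (i + 1) + j) - k h (u i + j)| :=
          Finset.sum_comm
      _ ≤ ∑ j ∈ Finset.range d, (eVariationOn (fun t => k h (t + j)) (Set.Icc 0 1)).toReal := by
          refine Finset.sum_le_sum fun j hj => ?_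
          have h1 : eVariationOn (fun t => k h (t + j)) (Set.Icc 0 1) ≤
              ENNReal.ofReal (eVariationOn (fun t => k h (t + j)) (Set.Icc 0 1)).toReal := by
            rw [ENNReal.ofReal_toReal (hfin j hj)]
          exact (eVariationOn_le_ofReal_iff ENNReal.toReal_nonneg).1 h1 n u hu hus
      _ = (eVariationOn (k h) (Set.Icc 0 d)).toReal := by
          rw [← ENNReal.toReal_sum hfin, hsplit]
      _ ≤ _ := ENNReal.toReal_le_of_le_ofReal hbd0 hvar
  · intro h v g a H hg ha
    set q : ℝ → ℝ := fun y => k h y * g y with hq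
    have hqm : Measurable q := (hkm h H.measurable).mul (hg.comp AddCircle.measurable_mk')
    have hqb : ∀ y, |q y| ≤ ((v / 2 + ∫ x, |h x|) * γ⁻¹) * a := by
      intro y
      simp only [hq, hk, abs_mul]
      have hI := BVBound.integral_abs_nonneg h
      have hv0 := H.nonneg
      refine mul_le_mul (mul_le_mul (H.abs_le _) (hinv _) (abs_nonneg _) (by positivity)) (ha _)
        (abs_nonneg _) (by positivity)
    have hqi : ∀ s t, IntervalIntegrable q volume s t := intervalIntegrable_of_bound hqm hqb
    have hqj : ∀ (j : ℕ) (t : ℝ), k h (t + j) * g t = q (t + j) := by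
      intro j t
      have := coe_add_intCast t j
      simp only [Int.cast_natCast] at this
      simp only [hq, this]
    calc ∫ x, L h x * g x = ∫ t in (0 : ℝ)..0 + 1, L h t * g t :=
          (UnitAddCircle.intervalIntegral_preimage 0 fun x => L h x * g x).symm
      _ = ∫ t in (0 : ℝ)..0 + 1, ∑ j ∈ Finset.range d, q (t + j) := by
          simp only [hLt, Finset.sum_mul, hqj]
      _ = ∑ j ∈ Finset.range d, ∫ t in (0 : ℝ)..0 + 1, q (t + j) :=
          intervalIntegral.integral_finsetSum fun j _ =>
            intervalIntegrable_of_bound (hqm.comp (measurable_id.add_const _)) (fun x => hqb _) _ _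
      _ = ∑ j ∈ Finset.range d, ∫ t in ((j : ℕ) : ℝ)..((j + 1 : ℕ) : ℝ), q t := by
          refine Finset.sum_congr rfl fun j _ => ?_
          rw [intervalIntegral.integral_comp_add_right]
          congr 1 <;> push_cast <;> ring
      _ = ∫ t in ((0 : ℕ) : ℝ)..d, q t :=
          intervalIntegral.sum_integral_adjacent_intervals (a := fun j : ℕ => (j : ℝ))
            fun j _ => hqi _ _
      _ = ∫ t in f '' Set.Ioc (e.symm 0) (e.symm 0 + 1), q t := by
          rw [intervalIntegral.integral_of_le (by simp)]
          have : f '' Set.Ioc (e.symm 0) (e.symm 0 + 1) = Set.Ioc (0 : ℝ) d := by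
            have h1 := e.image_Ioc (e.symm 0) (e.symm 0 + 1)
            have h2 : e (e.symm 0 + 1) = d := by rw [hef, hD', hfe, zero_add]
            rw [h2, e.apply_symm_apply] at h1
            exact h1
          rw [this, Nat.cast_zero]
      _ = ∫ t in Set.Ioc (e.symm 0) (e.symm 0 + 1), |f' t| • q (f t) :=
          integral_image_eq_integral_abs_deriv_smul measurableSet_Ioc
            (fun x _ => (hd x).hasDerivWithinAt) hmono.injective.injOn q
      _ = ∫ t in Set.Ioc (e.symm 0) (e.symm 0 + 1), h t * g (T t) := by
          congr 1
          funext t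
          simp only [hq, hk, hef', hf, smul_eq_mul, abs_of_pos (hpos t)]
          field_simp [(hpos t).ne']
      _ = ∫ x, h x * g (T x) :=
          UnitAddCircle.integral_preimage (e.symm 0) fun x => h x * g (T x)
  · intro h h0 x
    obtain ⟨t, rfl⟩ := QuotientAddGroup.mk_surjective x
    rw [← hf, hLt]
    -- The branch `j = 0` over the point `f t` is `t` itself. The other branches contribute
    -- nonnegative terms.
    have hd0 : 0 ∈ Finset.range d := Finset.mem_range.2 (by exact_mod_cast hDpos)
    refine le_trans ?_ (Finset.single_le_sum (f := fun j : ℕ => k h (f t + j))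
      (fun j _ => mul_nonneg (h0 _) (hinv0 _)) hd0)
    simp only [hk, Nat.cast_zero, add_zero, hef']
    rw [div_eq_mul_inv]
    exact mul_le_mul_of_nonneg_left (inv_anti₀ (hpos t) (hup t)) (h0 _)

lemma BVBound.comp_neg {h : Torus → ℝ} {v : ℝ} (H : BVBound h v) :
    BVBound (fun x => h (-x)) v := by
  refine ⟨H.measurable.comp measurable_neg, H.nonneg, ?_⟩
  have h1 := eVariationOn.comp_le_of_antitoneOn (fun t : ℝ => h t) (s := Set.Icc (-1) (-1 + 1))
    (t := Set.Icc (0 : ℝ) 1) (fun t => -t) (fun _ _ _ _ hxy => neg_le_neg hxy)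
    (fun t ht => ⟨neg_le_neg ht.2, by simpa using ht.1⟩)
  simpa [Function.comp_def] using h1.trans (H.le_period (-1))

/-- Up to composition with the reflection of the circle, an expanding map has an increasing
lift. -/
lemma IsExpanding.exists_increasing_lift {γ K K₁ : ℝ} {T : Torus → Torus} (hγ : 0 < γ)
    (hT : IsExpanding γ K K₁ T) :
    ∃ f f' : ℝ → ℝ, (∀ x, HasDerivAt f (f' x) x) ∧ (∀ x, γ ≤ f' x) ∧ (∀ x, f' x ≤ K) ∧
      (∀ x y : ℝ, |f' x - f' y| ≤ K₁ * |x - y|) ∧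
      ((∀ x : ℝ, ((f x : ℝ) : Torus) = T x) ∨ ∀ x : ℝ, ((f x : ℝ) : Torus) = T (-(x : Torus))) := by
  obtain ⟨f, f', hf, hd, hb, hlip⟩ := hT
  have hK₁ : 0 ≤ K₁ := by
    have := (abs_nonneg _).trans (hlip 1 0)
    simpa using this
  have hf'c : Continuous f' := by
    have : LipschitzWith (Real.toNNReal K₁) f' := LipschitzWith.of_dist_le_mul fun x y => by
      rw [Real.dist_eq, Real.dist_eq, Real.coe_toNNReal _ hK₁]
      exact hlip x y
    exact this.continuous
  have hne : ∀ x, f' x ≠ 0 := by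
    intro x hx
    have := (hb x).1
    rw [hx, abs_zero] at this
    linarith
  by_cases hpos : ∀ x, 0 < f' x
  · refine ⟨f, f', hd, ?_, ?_, hlip, Or.inl hf⟩
    · intro x; have := (hb x).1; rwa [abs_of_pos (hpos x)] at this
    · intro x; have := (hb x).2; rwa [abs_of_pos (hpos x)] at this
  · push Not at hpos
    obtain ⟨x₀, hx₀⟩ := hpos
    have hneg : ∀ x, f' x < 0 := by
      intro x
      by_contra hx
      push Not at hx
      obtain ⟨z, hz⟩ := mem_range_of_exists_le_of_exists_ge hf'c ⟨x₀, hx₀⟩ ⟨x, hx⟩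
      exact hne z hz
    refine ⟨fun x => f (-x), fun x => -f' (-x), ?_, ?_, ?_, ?_, Or.inr ?_⟩
    · intro x
      simpa [Function.comp_def] using (hd (-x)).comp x (hasDerivAt_neg x)
    · intro x; have := (hb (-x)).1; rwa [abs_of_neg (hneg _)] at this
    · intro x; have := (hb (-x)).2; rwa [abs_of_neg (hneg _)] at this
    · intro x y
      have := hlip (-y) (-x)
      have e1 : -f' (-x) - -f' (-y) = f' (-y) - f' (-x) := by ring
      have e2 : -y - -x = x - y := by ring
      rw [e1]
      rwa [e2] at this
    · intro x
      rw [hf, AddCircle.coe_neg]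

/-- For a decreasing lift, precompose with `x ↦ -x`, which preserves both Lebesgue measure and total
variation. -/
lemma IsExpanding.exists_transfer {γ K K₁ : ℝ} {T : Torus → Torus} (hγ : 0 < γ)
    (hT : IsExpanding γ K K₁ T) :
    ∃ L : (Torus → ℝ) →ₗ[ℝ] (Torus → ℝ), IsTransfer T γ⁻¹ (K₁ * (γ⁻¹ * γ⁻¹)) L ∧
      ∀ h : Torus → ℝ, (∀ x, 0 ≤ h x) → ∀ x, h x / K ≤ L h (T x) := by
  obtain ⟨f, f', hd, hlow, hup, hlip, hf | hf⟩ := hT.exists_increasing_lift hγ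
  · exact exists_transfer_of_monotone hγ hf hd hlow hup hlip
  · obtain ⟨L, hL, hLK⟩ := exists_transfer_of_monotone (T := fun x => T (-x)) hγ hf hd hlow hup hlip
    refine ⟨L ∘ₗ LinearMap.funLeft ℝ ℝ (fun x : Torus => -x), ⟨?_, ?_, ?_⟩, ?_⟩
    · intro h h0 x
      exact hL.nonneg _ (fun y => h0 _) x
    · intro h v H
      have h1 := hL.bv _ v H.comp_neg
      rwa [integral_neg_eq_self (fun x => |h x|) volume] at h1
    · intro h v g a H hg ha
      have h1 := hL.dual _ v g a H.comp_neg hg ha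
      rw [integral_neg_eq_self (fun x => h x * g (T x)) volume] at h1
      exact h1
    · intro h h0 x
      have h1 := hLK (fun y => h (-y)) (fun y => h0 _) (-x)
      simp only [neg_neg] at h1
      exact h1

lemma IsExpanding.measurable {γ K K₁ : ℝ} {T : Torus → Torus} (hT : IsExpanding γ K K₁ T) :
    Measurable T := by
  obtain ⟨f, f', hf, hd, -⟩ := hT
  refine measurable_of_comp_coe ?_
  simp only [← hf]
  have : Continuous f := continuous_iff_continuousAt.2 fun x => (hd x).continuousAt
  exact AddCircle.measurable_mk'.comp this.measurable

/-- The image of an interval of length `ℓ` contains an interval of length `γ * ℓ`. -/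
lemma IsExpanding.exists_interval_subset {γ K K₁ : ℝ} {T : Torus → Torus} (hγ : 0 < γ)
    (hT : IsExpanding γ K K₁ T) {p q : ℝ} (hpq : p ≤ q) :
    ∃ r : ℝ, ∀ y ∈ Set.Icc r (r + γ * (q - p)), ∃ x ∈ Set.Icc p q, T (x : Torus) = (y : Torus) := by
  obtain ⟨f, f', hd, hlow, hup, hlip, hf⟩ := hT.exists_increasing_lift hγ
  have hdiff : Differentiable ℝ f := fun x => (hd x).differentiableAt
  have hgrow : ∀ ⦃x y : ℝ⦄, x ≤ y → γ * (y - x) ≤ f y - f x :=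
    mul_sub_le_image_sub_of_le_deriv hdiff fun x => by rw [(hd x).deriv]; exact hlow x
  have himg : ∀ s t, s ≤ t → ∀ y ∈ Set.Icc (f s) (f s + γ * (t - s)), ∃ x ∈ Set.Icc s t, f x = y := by
    intro s t hst y hy
    have := intermediate_value_Icc hst hdiff.continuous.continuousOn
    exact this ⟨hy.1, by linarith [hy.2, hgrow hst]⟩
  rcases hf with hf | hf
  · refine ⟨f p, fun y hy => ?_⟩
    obtain ⟨x, hx, rfl⟩ := himg p q hpq y hy
    exact ⟨x, hx, (hf x).symm⟩
  · refine ⟨f (-q), fun y hy => ?_⟩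
    obtain ⟨x, hx, rfl⟩ := himg (-q) (-p) (neg_le_neg hpq) y (by
      have : -p - -q = q - p := by ring
      rwa [this])
    refine ⟨-x, ⟨by linarith [hx.2], by linarith [hx.1]⟩, ?_⟩
    rw [hf, AddCircle.coe_neg]

namespace IsTransfer

variable {S : Torus → Torus} {α D : ℝ} {L : (Torus → ℝ) →ₗ[ℝ] (Torus → ℝ)}

/-- Duality tested against the sign of `L h`. -/
lemma integral_abs_le (hL : IsTransfer S α D L) (hS : Measurable S) {h : Torus → ℝ} {v : ℝ}
    (H : BVBound h v) : ∫ x, |L h x| ≤ ∫ x, |h x| := by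
  have hLH := hL.bv h v H
  set g : Torus → ℝ := fun x => if 0 ≤ L h x then 1 else -1 with hg
  have hgm : Measurable g :=
    Measurable.ite (measurableSet_le measurable_const hLH.measurable) measurable_const
      measurable_const
  have hgb : ∀ x, |g x| ≤ 1 := by
    intro x
    simp only [hg]
    split_ifs <;> simp
  have h1 := hL.dual h v g 1 H hgm hgb
  have h2 : ∀ x, L h x * g x = |L h x| := by
    intro x
    simp only [hg]
    split_ifs with hx
    · rw [abs_of_nonneg hx, mul_one]
    · rw [abs_of_neg (not_le.1 hx)]
      ring
  simp only [h2] at h1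
  rw [h1]
  have h3 : ∀ x, |h x * g (S x)| ≤ |h x| := by
    intro x
    rw [abs_mul]
    exact mul_le_of_le_one_right (abs_nonneg _) (hgb _)
  refine integral_mono ?_ H.integrable.abs fun x => (le_abs_self _).trans (h3 x)
  exact H.integrable.abs.mono' (H.measurable.mul (hgm.comp hS)).aestronglyMeasurable
    (Filter.Eventually.of_forall h3)

end IsTransfer

open Classical in
/-- The transfer operator of a map which is `S₁ ∘ S₂ ∘ S₁` on an arc and `S₁` off that arc. -/
lemma exists_transfer_piecewise {S₁ S₂ : Torus → Torus} {α D K : ℝ} {W : Set Torus}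
    {L₁ L₂ : (Torus → ℝ) →ₗ[ℝ] (Torus → ℝ)} (hL₁ : IsTransfer S₁ α D L₁)
    (hL₂ : IsTransfer S₂ α D L₂) (hS₁ : Measurable S₁) (hS₂ : Measurable S₂)
    (hα0 : 0 ≤ α) (hα1 : α ≤ 1) (hD : 0 ≤ D) (hW : IsArc W) (hW1 : volume.real W < 1)
    (hK : ∀ h : Torus → ℝ, (∀ x, 0 ≤ h x) → ∀ x, h x / K ≤ L₁ h (S₁ x)) :
    ∃ L : (Torus → ℝ) →ₗ[ℝ] (Torus → ℝ),
      IsTransfer (fun x => if x ∈ W then S₁ (S₂ (S₁ x)) else S₁ x)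
        (2 * α + 2 * α ^ 3) (2 * α + 2 * α ^ 3 + 4 * D) L ∧
      ∀ h : Torus → ℝ, (∀ x, 0 ≤ h x) → ∀ x, x ∉ W → h x / K ≤ L h (S₁ x) := by
  have hWm := hW.measurableSet hW1
  set χ : Torus → ℝ := W.indicator 1 with hχ
  have hχval : ∀ x, χ x = if x ∈ W then 1 else 0 := fun x => by
    simp [hχ, Set.indicator_apply]
  have hχ0 : ∀ x, 0 ≤ χ x := fun x => by rw [hχval]; split_ifs <;> norm_num
  have hχ1 : ∀ x, χ x ≤ 1 := fun x => by rw [hχval]; split_ifs <;> norm_num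
  have hχb : BVBound χ 2 := hW.bvBound_indicator hW1
  set χ' : Torus → ℝ := (fun _ => 1) - χ with hχ'
  have hχ'val : ∀ x, χ' x = 1 - χ x := fun x => rfl
  have hχ'b : BVBound χ' 2 := by
    have := (BVBound.const 1).sub hχb
    rwa [zero_add] at this
  have habs : ∀ x, |χ x| ≤ 1 := fun x => by rw [abs_of_nonneg (hχ0 x)]; exact hχ1 x
  have habs' : ∀ x, |χ' x| ≤ 1 := fun x => by
    rw [hχ'val, abs_of_nonneg (by linarith [hχ1 x])]
    linarith [hχ0 x]
  -- The cut-off contributes its variation 2 times the sup bound `v / 2 + ∫ |h|`, and `h`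
  -- contributes its own variation `v`.
  have hcut : ∀ (ψ h : Torus → ℝ) (v : ℝ), BVBound ψ 2 → (∀ x, |ψ x| ≤ 1) → BVBound h v →
      BVBound (ψ * h) (2 * v + 2 * ∫ x, |h x|) := by
    intro ψ h v hψ hψ1 H
    have := hψ.mul H hψ1 H.abs_le
    convert this using 1
    ring
  have hcutI : ∀ (ψ h : Torus → ℝ) (v : ℝ), BVBound ψ 2 → (∀ x, |ψ x| ≤ 1) → BVBound h v →
      ∫ x, |(ψ * h) x| ≤ ∫ x, |h x| := by
    intro ψ h v hψ hψ1 H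
    refine integral_mono (hcut ψ h v hψ hψ1 H).integrable.abs H.integrable.abs fun x => ?_
    simp only [Pi.mul_apply, abs_mul]
    exact mul_le_of_le_one_left (abs_nonneg _) (hψ1 x)
  refine ⟨L₁ ∘ₗ LinearMap.mulLeft ℝ χ' + L₁ ∘ₗ L₂ ∘ₗ L₁ ∘ₗ LinearMap.mulLeft ℝ χ,
    ⟨?_, ?_, ?_⟩, ?_⟩
  · intro h h0 x
    refine add_nonneg (hL₁.nonneg _ (fun y => ?_) x)
      (hL₁.nonneg _ (hL₂.nonneg _ (hL₁.nonneg _ fun y => ?_)) x)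
    · exact mul_nonneg (by rw [hχ'val]; linarith [hχ1 y]) (h0 y)
    · exact mul_nonneg (hχ0 y) (h0 y)
  · intro h v H
    have hI := BVBound.integral_abs_nonneg h
    have hv0 := H.nonneg
    have a1 := hL₁.bv _ _ (hcut χ' h v hχ'b habs' H)
    have a2 := hcut χ h v hχb habs H
    have a3 := hL₁.bv _ _ a2
    have a4 := hL₂.bv _ _ a3
    have a5 := hL₁.bv _ _ a4
    have i1 := hcutI χ' h v hχ'b habs' H
    have i2 := hcutI χ h v hχb habs H
    have i3 := (hL₁.integral_abs_le hS₁ a2).trans i2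
    have i4 := (hL₂.integral_abs_le hS₂ a3).trans i3
    refine (a1.add a5).mono ?_
    set I := ∫ x, |h x|
    have j1 := mul_le_mul_of_nonneg_left i1 hD
    have j2 := mul_le_mul_of_nonneg_left i2 hD
    have j3 := mul_le_mul_of_nonneg_left i3 hD
    have j4 := mul_le_mul_of_nonneg_left i4 hD
    have hDI : 0 ≤ D * I := mul_nonneg hD hI
    -- Since `α ≤ 1`, each of the four operator applications adds at most `D * I`: one on the
    -- complement of `W` and three on `W`. This is the term `4 * D`.
    have k2 : α * (α * (2 * v + 2 * I) + D * ∫ x, |(χ * h) x|) ≤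
        α ^ 2 * (2 * v + 2 * I) + D * I := by
      have := mul_le_mul_of_nonneg_left j2 hα0
      have := mul_le_of_le_one_left hDI hα1
      nlinarith
    have k3 : α * (α * (α * (2 * v + 2 * I) + D * ∫ x, |(χ * h) x|) +
        D * ∫ x, |L₁ (χ * h) x|) ≤ α ^ 3 * (2 * v + 2 * I) + 2 * (D * I) := by
      have h1 := mul_le_mul_of_nonneg_left (add_le_add k2 j3) hα0
      have h2 := mul_le_of_le_one_left hDI hα1
      nlinarith
    linarith
  · intro h v g a H hg ha
    have a2 := hcut χ h v hχb habs H
    have a3 := hL₁.bv _ _ a2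
    have a4 := hL₂.bv _ _ a3
    have a1' := hcut χ' h v hχ'b habs' H
    have a1 := hL₁.bv _ _ a1'
    have a5 := hL₁.bv _ _ a4
    have hint : ∀ (u : Torus → ℝ) (w : ℝ) (k : Torus → ℝ), BVBound u w → Measurable k →
        (∀ x, |k x| ≤ a) → Integrable (fun x => u x * k x) := by
      intro u w k hu hk hka
      exact hu.integrable.mul_bdd (c := a) hk.aestronglyMeasurable
        (Filter.Eventually.of_forall hka)
    have hg1 := hg.comp hS₁
    have hg2 := hg1.comp hS₂
    have hg3 := hg2.comp hS₁
    calc ∫ x, (L₁ (χ' * h) x + L₁ (L₂ (L₁ (χ * h))) x) * g x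
        = ∫ x, (L₁ (χ' * h) x * g x + L₁ (L₂ (L₁ (χ * h))) x * g x) := by
          simp only [add_mul]
      _ = (∫ x, L₁ (χ' * h) x * g x) + ∫ x, L₁ (L₂ (L₁ (χ * h))) x * g x :=
          integral_add (hint _ _ _ a1 hg ha) (hint _ _ _ a5 hg ha)
      _ = (∫ x, (χ' * h) x * g (S₁ x)) + ∫ x, (χ * h) x * g (S₁ (S₂ (S₁ x))) := by
          rw [hL₁.dual _ _ g a a1' hg ha, hL₁.dual _ _ g a a4 hg ha,
            hL₂.dual _ _ (fun x => g (S₁ x)) a a3 hg1 fun x => ha _,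
            hL₁.dual _ _ (fun x => g (S₁ (S₂ x))) a a2 hg2 fun x => ha _]
      _ = ∫ x, ((χ' * h) x * g (S₁ x) + (χ * h) x * g (S₁ (S₂ (S₁ x)))) :=
          (integral_add (hint _ _ (fun x => g (S₁ x)) a1' hg1 fun x => ha _)
            (hint _ _ (fun x => g (S₁ (S₂ (S₁ x)))) a2 hg3 fun x => ha _)).symm
      _ = _ := by
          congr 1
          funext x
          simp only [Pi.mul_apply, hχ'val, hχval]
          split_ifs <;> ring
  · intro h h0 x hx
    have h1 := hK (χ' * h) (fun y => mul_nonneg (by rw [hχ'val]; linarith [hχ1 y]) (h0 y)) x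
    have h2 : (χ' * h) x = h x := by
      simp [hχ'val, hχval, hx]
    rw [h2] at h1
    have h3 := hL₁.nonneg _ (hL₂.nonneg _ (hL₁.nonneg (χ * h) fun y =>
      mul_nonneg (hχ0 y) (h0 y))) (S₁ x)
    exact h1.trans (le_add_of_nonneg_right h3)

/-! ### Sequential compositions of transfer operators -/

/-- `iterOp L n k` is the composition `L (n + k - 1) ∘ ⋯ ∘ L n` of `k` operators. -/
def iterOp (L : ℤ → (Torus → ℝ) →ₗ[ℝ] (Torus → ℝ)) (n : ℤ) :
    ℕ → (Torus → ℝ) →ₗ[ℝ] (Torus → ℝ)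
  | 0 => LinearMap.id
  | k + 1 => L (n + (k : ℤ)) ∘ₗ iterOp L n k

lemma iterOp_add (L : ℤ → (Torus → ℝ) →ₗ[ℝ] (Torus → ℝ)) (n : ℤ) (i k : ℕ) (h : Torus → ℝ) :
    iterOp L n (i + k) h = iterOp L (n + i) k (iterOp L n i h) := by
  induction k with
  | zero => rfl
  | succ k ih =>
    change L (n + ((i + k : ℕ) : ℤ)) (iterOp L n (i + k) h) =
      L (n + i + k) (iterOp L (n + i) k (iterOp L n i h))
    rw [ih]
    push_cast
    rw [add_assoc]

lemma compFrom_add (S : ℤ → Torus → Torus) (n : ℤ) (i k : ℕ) (x : Torus) :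
    compFrom S n (i + k) x = compFrom S (n + i) k (compFrom S n i x) := by
  induction k with
  | zero => rfl
  | succ k ih =>
    change S (n + ((i + k : ℕ) : ℤ)) (compFrom S n (i + k) x) =
      S (n + i + k) (compFrom S (n + i) k (compFrom S n i x))
    rw [ih]
    push_cast
    rw [add_assoc]

/-- A sequence of maps `G n` with transfer operators `L n`, where `G n` agrees off the small arc
`W n` with a map `T n` that expands intervals by the factor three. -/
structure TransferSystem (θ D K δ : ℝ) (T G : ℤ → Torus → Torus) (W : ℤ → Set Torus)
    (L : ℤ → (Torus → ℝ) →ₗ[ℝ] (Torus → ℝ)) : Prop where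
  transfer : ∀ n, IsTransfer (G n) θ D (L n)
  measurable : ∀ n, Measurable (G n)
  arc : ∀ n, IsArc (W n)
  pos : 0 < δ
  small : ∀ n, volume.real (W n) ≤ δ
  lower : ∀ n (h : Torus → ℝ), (∀ x, 0 ≤ h x) → ∀ x, x ∉ W n → h x / K ≤ L n h (T n x)
  expand : ∀ n (p q : ℝ), p ≤ q → ∃ r : ℝ, ∀ y ∈ Set.Icc r (r + 3 * (q - p)),
    ∃ x ∈ Set.Icc p q, T n (x : Torus) = (y : Torus)

namespace TransferSystem

variable {θ D K δ : ℝ} {T G : ℤ → Torus → Torus} {W : ℤ → Set Torus}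
  {L : ℤ → (Torus → ℝ) →ₗ[ℝ] (Torus → ℝ)}

lemma measurable_compFrom (H : TransferSystem θ D K δ T G W L) (n : ℤ) (k : ℕ) :
    Measurable (compFrom G n k) := by
  induction k with
  | zero => exact measurable_id
  | succ k ih => exact (H.measurable _).comp ih

lemma iterOp_nonneg (H : TransferSystem θ D K δ T G W L) (n : ℤ) (k : ℕ) {h : Torus → ℝ}
    (h0 : ∀ x, 0 ≤ h x) : ∀ x, 0 ≤ iterOp L n k h x := by
  induction k with
  | zero => exact h0
  | succ k ih => exact (H.transfer _).nonneg _ ih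

/-- The one-step inequality is iterated. The L¹ coefficient `D / (1 - θ)` is the fixed point of `B ↦
θ * B + D`, so it reproduces itself at each step. -/
lemma iterOp_bv_abs (H : TransferSystem θ D K δ T G W L) (hθ1 : θ < 1) (hD : 0 ≤ D)
    (n : ℤ) (k : ℕ) {h : Torus → ℝ} {v : ℝ} (hv : BVBound h v) :
    BVBound (iterOp L n k h) (θ ^ k * v + D / (1 - θ) * ∫ x, |h x|) ∧
      ∫ x, |iterOp L n k h x| ≤ ∫ x, |h x| := by
  have h1 : 0 < 1 - θ := by linarith
  have hI := BVBound.integral_abs_nonneg h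
  induction k with
  | zero =>
    refine ⟨hv.mono ?_, le_rfl⟩
    have : 0 ≤ D / (1 - θ) * ∫ x, |h x| := by positivity
    simpa using this
  | succ k ih =>
    refine ⟨((H.transfer (n + k)).bv _ _ ih.1).mono ?_,
      ((H.transfer (n + k)).integral_abs_le (H.measurable _) ih.1).trans ih.2⟩
    have h2 := mul_le_mul_of_nonneg_left ih.2 hD
    have h3 : D / (1 - θ) = θ * (D / (1 - θ)) + D := by
      field_simp
      ring
    calc _ ≤ θ * (θ ^ k * v + D / (1 - θ) * ∫ x, |h x|) + D * ∫ x, |h x| := by linarith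
      _ = θ ^ (k + 1) * v + (θ * (D / (1 - θ)) + D) * ∫ x, |h x| := by ring
      _ = _ := by rw [← h3]

lemma iterOp_dual (H : TransferSystem θ D K δ T G W L) (hθ1 : θ < 1) (hD : 0 ≤ D)
    (n : ℤ) (k : ℕ) {h g : Torus → ℝ} {v a : ℝ} (hv : BVBound h v) (hg : Measurable g)
    (ha : ∀ x, |g x| ≤ a) :
    ∫ x, iterOp L n k h x * g x = ∫ x, h x * g (compFrom G n k x) := by
  induction k generalizing g with
  | zero => rfl
  | succ k ih =>
    change ∫ x, L (n + k) (iterOp L n k h) x * g x = ∫ x, h x * g (G (n + k) (compFrom G n k x))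
    rw [(H.transfer (n + k)).dual _ _ g a (H.iterOp_bv_abs hθ1 hD n k hv).1 hg ha]
    exact ih (hg.comp (H.measurable _)) fun x => ha _

lemma integral_iterOp (H : TransferSystem θ D K δ T G W L) (hθ1 : θ < 1)
    (hD : 0 ≤ D) (n : ℤ) (k : ℕ) {h : Torus → ℝ} {v : ℝ} (hv : BVBound h v) :
    ∫ x, iterOp L n k h x = ∫ x, h x := by
  simpa using H.iterOp_dual hθ1 hD n k hv (g := fun _ => 1) (a := 1) measurable_const (by simp)

/-- A lower bound on an interval is transported to a lower bound on a longer interval. -/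
lemma exists_lower_bound_interval (H : TransferSystem θ D K δ T G W L) (hK : 0 < K) (n : ℤ)
    {h : Torus → ℝ} (h0 : ∀ x, 0 ≤ h x) {a p ℓ : ℝ} (hℓ : ℓ ≤ 3 / 4)
    (hδ : 24 * δ ≤ ℓ) (ha : ∀ x ∈ Set.Icc p (p + ℓ), a ≤ h (x : Torus)) :
    ∃ r : ℝ, ∀ y ∈ Set.Icc r (r + 3 * (ℓ / 2 - δ)), a / K ≤ L n h (y : Torus) := by
  have hδ0 := H.pos
  have key : ∀ s t, s ≤ t → t - s = ℓ / 2 - δ → p ≤ s → t ≤ p + ℓ →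
      (∀ x ∈ Set.Icc s t, (x : Torus) ∉ W n) →
      ∃ r : ℝ, ∀ y ∈ Set.Icc r (r + 3 * (ℓ / 2 - δ)), a / K ≤ L n h (y : Torus) := by
    intro s t hst hlen hs ht hfree
    obtain ⟨r, hr⟩ := H.expand n s t hst
    rw [hlen] at hr
    refine ⟨r, fun y hy => ?_⟩
    obtain ⟨x, hx, hxy⟩ := hr y hy
    rw [← hxy]
    refine le_trans ?_ (H.lower n h h0 x (hfree x hx))
    exact div_le_div_of_nonneg_right (ha x ⟨hs.trans hx.1, hx.2.trans ht⟩) hK.le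
  -- The two end pieces of length `ℓ / 2 - δ` are `2 * δ` apart, so an arc of length at most `δ`
  -- cannot meet both.
  by_cases hfree : ∀ x ∈ Set.Icc p (p + (ℓ / 2 - δ)), (x : Torus) ∉ W n
  · exact key _ _ (by linarith) (by ring) le_rfl (by linarith) hfree
  · push Not at hfree
    obtain ⟨s, hs, hsW⟩ := hfree
    refine key (p + ℓ / 2 + δ) (p + ℓ) (by linarith) (by ring) (by linarith) le_rfl ?_
    intro t ht htW
    have h1 : |s - t| = t - s := by
      rw [abs_sub_comm, abs_of_nonneg]
      linarith [hs.2, ht.1]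
    have h2 := H.small n
    have h3 := (H.arc n).abs_sub_le hsW htW (by
      rw [h1]
      linarith [hs.1, ht.2])
    rw [h1] at h3
    linarith [hs.2, ht.1]

/-- After sufficiently many steps a lower bound on an interval becomes a global lower bound. -/
lemma lower_bound_iterOp_of_interval (H : TransferSystem θ D K δ T G W L) (hK : 0 < K) (M : ℕ) :
    ∀ (n : ℤ) {h : Torus → ℝ}, (∀ x, 0 ≤ h x) → ∀ {a p : ℝ},
    24 * δ ≤ 3 / 4 * (4 / 5) ^ M →
    (∀ x ∈ Set.Icc p (p + 3 / 4 * (4 / 5) ^ M), a ≤ h (x : Torus)) →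
    ∀ x, a / K ^ (M + 1) ≤ iterOp L n (M + 1) h x := by
  induction M with
  | zero =>
    intro n h h0 a p hδ ha x
    simp only [pow_zero, mul_one] at hδ ha
    -- For `ℓ = 3 / 4` and `δ ≤ 1 / 32` the image has length at least 33/32, which covers the
    -- circle.
    obtain ⟨r, hr⟩ := H.exists_lower_bound_interval hK n h0 le_rfl hδ ha
    have hx := (AddCircle.equivIco 1 r x).2
    have h1 := hr (AddCircle.equivIco 1 r x) ⟨hx.1, by linarith [hx.2]⟩
    have h2 : (((AddCircle.equivIco 1 r x : Set.Ico r (r + 1)) : ℝ) : Torus) = x :=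
      (AddCircle.equivIco 1 r).symm_apply_apply x
    rw [h2] at h1
    simpa [iterOp] using h1
  | succ M ih =>
    intro n h h0 a p hδ ha x
    have hpow : (3 / 4 : ℝ) * (4 / 5) ^ (M + 1) = 4 / 5 * (3 / 4 * (4 / 5) ^ M) := by ring
    have hle : (3 / 4 : ℝ) * (4 / 5) ^ M ≤ 3 / 4 :=
      mul_le_of_le_one_right (by norm_num) (pow_le_one₀ (by norm_num) (by norm_num))
    rw [hpow] at hδ ha
    set ℓ : ℝ := 3 / 4 * (4 / 5) ^ M with hℓ
    -- As `24 * δ` is at most the current length, that length grows by a factor at least 3/2 - 1/8 =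
    -- 11/8. A factor 5/4 suffices for the induction.
    obtain ⟨r, hr⟩ := H.exists_lower_bound_interval hK n h0 (by linarith [H.pos]) hδ ha
    have h1 := ih (n + 1) ((H.transfer n).nonneg h h0) (a := a / K) (p := r)
      (by linarith [H.pos]) (fun y hy => hr y ⟨hy.1, by linarith [hy.2, H.pos]⟩) x
    have h2 := iterOp_add L n 1 (M + 1) h
    rw [add_comm 1 (M + 1)] at h2
    rw [h2]
    have h3 : iterOp L n 1 h = L n h := by simp [iterOp]
    rw [h3]
    refine le_trans (le_of_eq ?_) h1
    rw [pow_succ K (M + 1), div_div, mul_comm K]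

/-- A global lower bound stays a global lower bound. -/
lemma lower_bound_iterOp (H : TransferSystem θ D K δ T G W L) (hK : 0 < K) (hδ : 32 * δ ≤ 1)
    (n : ℤ) (k : ℕ) {h : Torus → ℝ} {a : ℝ} (ha0 : 0 ≤ a) (ha : ∀ x, a ≤ h x) :
    ∀ x, a / K ^ k ≤ iterOp L n k h x := by
  induction k with
  | zero => simpa [iterOp] using ha
  | succ k ih =>
    intro x
    have h1 := H.lower_bound_iterOp_of_interval hK 0 (n + k) (h := iterOp L n k h)
      (fun y => (by positivity : (0 : ℝ) ≤ a / K ^ k).trans (ih y)) (a := a / K ^ k) (p := 0)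
      (by linarith) (fun y _ => ih y) x
    rw [pow_succ K k, ← div_div]
    simpa [iterOp] using h1

end TransferSystem

/-- A nonnegative function of bounded variation is bounded below on some interval. -/
lemma BVBound.exists_interval_lower {h : Torus → ℝ} {v : ℝ} (H : BVBound h v) {N : ℕ} (hN : 0 < N)
    (hv : 2 * v ≤ N * ∫ x, h x) :
    ∃ p : ℝ, ∀ x ∈ Set.Icc p (p + 1 / N), (∫ y, h y) / 2 ≤ h (x : Torus) := by
  by_contra hcon
  push Not at hcon
  have hN' : (0 : ℝ) < N := by exact_mod_cast hN
  -- If every cell had a point with value below half the integral `I`, then `I` would be less than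
  -- `I / 2 + v / N`, which is at most `I`.
  choose x hx hxlt using fun j : ℕ => hcon (j / N : ℝ)
  set I := ∫ y, h y with hI
  set V : ℕ → ℝ := fun j =>
    (eVariationOn (fun t : ℝ => h t) (Set.Icc ((j : ℝ) / N) (((j + 1 : ℕ) : ℝ) / N))).toReal with hV
  have hstep : ∀ j : ℕ, (j : ℝ) / N + 1 / N = ((j + 1 : ℕ) : ℝ) / N := by
    intro j; push_cast; ring
  have hmono : Monotone fun j : ℕ => (j : ℝ) / N := fun i j hij => by
    have : (i : ℝ) ≤ j := by exact_mod_cast hij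
    exact div_le_div_of_nonneg_right this hN'.le
  have hsum := eVariationOn.sum' (fun t : ℝ => h t) hmono (n := N)
  have e0 : ((0 : ℕ) : ℝ) / N = 0 := by simp
  have e1 : ((N : ℕ) : ℝ) / N = 1 := div_self hN'.ne'
  rw [e0, e1] at hsum
  have hfin : ∀ j ∈ Finset.range N,
      eVariationOn (fun t : ℝ => h t) (Set.Icc ((j : ℝ) / N) (((j + 1 : ℕ) : ℝ) / N)) ≠ ⊤ := by
    intro j hj
    refine ne_top_of_le_ne_top ENNReal.ofReal_ne_top (le_trans ?_ (hsum.le.trans H.le))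
    exact Finset.single_le_sum (f := fun j : ℕ => eVariationOn (fun t : ℝ => h t)
      (Set.Icc ((j : ℝ) / N) (((j + 1 : ℕ) : ℝ) / N))) (fun _ _ => zero_le) hj
  have hVsum : ∑ j ∈ Finset.range N, V j ≤ v := by
    rw [hV, ← ENNReal.toReal_sum hfin, hsum]
    exact ENNReal.toReal_le_of_le_ofReal H.nonneg H.le
  have hint : ∀ p q, IntervalIntegrable (fun t : ℝ => h t) volume p q := fun p q =>
    intervalIntegrable_of_bound (H.measurable.comp AddCircle.measurable_mk')
      (fun t => H.abs_le t) p q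
  have hpiece : ∀ j ∈ Finset.range N,
      ∫ t in ((j : ℝ) / N)..(((j + 1 : ℕ) : ℝ) / N), h t ≤ (h (x j) + V j) * (1 / N) := by
    intro j hj
    have hle := hmono (Nat.le_succ j)
    have h1 : ∫ t in ((j : ℝ) / N)..(((j + 1 : ℕ) : ℝ) / N), h t ≤
        ∫ _ in ((j : ℝ) / N)..(((j + 1 : ℕ) : ℝ) / N), (h (x j) + V j) := by
      refine intervalIntegral.integral_mono_on hle (hint _ _) intervalIntegrable_const ?_
      intro t ht
      have hxj := hx j
      rw [hstep] at hxj
      have h2 := eVariationOn.edist_le (fun t : ℝ => h t) ht hxj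
      rw [edist_dist, ENNReal.ofReal_le_iff_le_toReal (hfin j hj), Real.dist_eq] at h2
      linarith [le_abs_self (h t - h (x j))]
    refine h1.trans (le_of_eq ?_)
    rw [intervalIntegral.integral_const, smul_eq_mul, ← hstep]
    ring
  have hItot : I = ∑ j ∈ Finset.range N, ∫ t in ((j : ℝ) / N)..(((j + 1 : ℕ) : ℝ) / N), h t := by
    rw [intervalIntegral.sum_integral_adjacent_intervals (a := fun j : ℕ => (j : ℝ) / N)
      fun j _ => hint _ _, e0, e1, hI]
    have := UnitAddCircle.intervalIntegral_preimage 0 h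
    rw [zero_add] at this
    exact this.symm
  have hlt : ∑ j ∈ Finset.range N, (h (x j) + V j) * (1 / N) <
      ∑ j ∈ Finset.range N, (I / 2 + V j) * (1 / N) := by
    refine Finset.sum_lt_sum_of_nonempty ⟨0, Finset.mem_range.2 hN⟩ fun j _ => ?_
    refine mul_lt_mul_of_pos_right ?_ (by positivity)
    linarith [hxlt j]
  have hle := Finset.sum_le_sum hpiece
  have hconst : ∑ j ∈ Finset.range N, (I / 2 + V j) * (1 / N) =
      (N * (I / 2) + ∑ j ∈ Finset.range N, V j) * (1 / N) := by
    rw [← Finset.sum_mul, Finset.sum_add_distrib, Finset.sum_const, Finset.card_range,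
      nsmul_eq_mul]
  rw [hconst] at hlt
  have h3 : (N * (I / 2) + ∑ j ∈ Finset.range N, V j) * (1 / N) ≤ I := by
    rw [mul_one_div, div_le_iff₀ hN']
    linarith
  linarith

/-! ### Uniform positivity and exponential decay of correlations -/

namespace TransferSystem

/-- Nonnegative functions whose variation is controlled by their integral become uniformly
positive. -/
lemma exists_uniform_lower_bound {B K : ℝ} (hK : 1 ≤ K) :
    ∃ (m : ℕ) (ε δ₁ : ℝ), 0 < m ∧ 0 < ε ∧ ε ≤ 1 ∧ ε ≤ 1 / K ^ m ∧ 0 < δ₁ ∧ 32 * δ₁ ≤ 1 ∧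
      ∀ (θ D δ : ℝ) (T G : ℤ → Torus → Torus) (W : ℤ → Set Torus)
        (L : ℤ → (Torus → ℝ) →ₗ[ℝ] (Torus → ℝ)), TransferSystem θ D K δ T G W L → δ ≤ δ₁ →
        ∀ (n : ℤ) (h : Torus → ℝ) (v : ℝ), BVBound h v → (∀ x, 0 ≤ h x) → v ≤ B * ∫ x, h x →
          ∀ x, ε * ∫ y, h y ≤ iterOp L n m h x := by
  obtain ⟨N, hN⟩ := exists_nat_gt (max 0 (2 * B))
  have hN0 : (0 : ℝ) < N := (le_max_left _ _).trans_lt hN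
  have hNB : 2 * B ≤ N := (le_max_right _ _).trans hN.le
  -- An interval of length `3 / 4 * (4 / 5) ^ M` then fits into the one of length `1 / N`. The
  -- witness `δ₁ = (4 / 5) ^ M / 32` is the largest `δ` allowed with this length.
  obtain ⟨M, hM⟩ := exists_pow_lt_of_lt_one (by positivity : (0 : ℝ) < 1 / N)
    (by norm_num : (4 / 5 : ℝ) < 1)
  have hK0 : 0 < K := by linarith
  have hpow0 : (0 : ℝ) < (4 / 5) ^ M := by positivity
  have hpow1 : ((4 : ℝ) / 5) ^ M ≤ 1 := pow_le_one₀ (by norm_num) (by norm_num)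
  have hKpow : 1 ≤ K ^ (M + 1) := one_le_pow₀ hK
  refine ⟨M + 1, 1 / (2 * K ^ (M + 1)), (4 / 5) ^ M / 32, by omega, by positivity, ?_, ?_,
    by positivity, by linarith, ?_⟩
  · rw [div_le_one (by positivity)]
    linarith
  · exact one_div_le_one_div_of_le (by positivity) (by linarith)
  · intro θ D δ T G W L H hδ n h v hv h0 hvB x
    have hI : 0 ≤ ∫ y, h y := integral_nonneg h0
    obtain ⟨p, hp⟩ := hv.exists_interval_lower (N := N) (by exact_mod_cast hN0)
      (by nlinarith [mul_le_mul_of_nonneg_right hNB hI])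
    have h1 := H.lower_bound_iterOp_of_interval hK0 M n h0 (a := (∫ y, h y) / 2) (p := p)
      (by linarith) (fun y hy => hp y ⟨hy.1, by linarith [hy.2]⟩) x
    refine le_trans (le_of_eq ?_) h1
    rw [div_div, one_div, inv_mul_eq_div]

end TransferSystem
namespace TransferSystem

variable {θ D K δ : ℝ} {T G : ℤ → Torus → Torus} {W : ℤ → Set Torus}
  {L : ℤ → (Torus → ℝ) →ₗ[ℝ] (Torus → ℝ)}

/-- A common lower bound for the images of the positive and the negative part of a function of
zero mean makes its `L¹` norm shrink. -/
lemma integral_abs_iterOp_le_of_lower_bound (H : TransferSystem θ D K δ T G W L) (hθ1 : θ < 1)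
    (hD : 0 ≤ D) {B ε : ℝ} {m : ℕ}
    (hlow : ∀ (n : ℤ) (h : Torus → ℝ) (v : ℝ), BVBound h v → (∀ x, 0 ≤ h x) →
      v ≤ 2 * B * ∫ x, h x → ∀ x, ε * ∫ y, h y ≤ iterOp L n m h x)
    (n : ℤ) {h : Torus → ℝ} {v : ℝ} (hv : BVBound h v) (hmean : ∫ x, h x = 0)
    (hvB : v ≤ B * ∫ x, |h x|) :
    ∫ x, |iterOp L n m h x| ≤ (1 - ε) * ∫ x, |h x| := by
  set I := ∫ x, |h x| with hI
  set hp : Torus → ℝ := fun x => max (h x) 0 with hhp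
  set hn : Torus → ℝ := fun x => max ((-h) x) 0 with hhn
  have bp : BVBound hp v := hv.posPart
  have bn : BVBound hn v := by
    have h1 : BVBound (-h) v := by simpa using hv.smul (-1)
    exact h1.posPart
  have hsub : h = hp - hn := by
    funext x
    simp only [hhp, hhn, Pi.sub_apply, Pi.neg_apply]
    rcases le_total 0 (h x) with hx | hx
    · rw [max_eq_left hx, max_eq_right (by linarith)]; ring
    · rw [max_eq_right hx, max_eq_left (by linarith)]; ring
  have habs : ∀ x, |h x| = hp x + hn x := by
    intro x
    simp only [hhp, hhn, Pi.neg_apply]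
    rcases le_total 0 (h x) with hx | hx
    · rw [max_eq_left hx, max_eq_right (by linarith), abs_of_nonneg hx]; ring
    · rw [max_eq_right hx, max_eq_left (by linarith), abs_of_nonpos hx]; ring
  have i1 : I = (∫ x, hp x) + ∫ x, hn x := by
    rw [hI, ← integral_add bp.integrable bn.integrable]
    simp only [habs]
  have i2 : (∫ x, hp x) - ∫ x, hn x = 0 := by
    rw [← integral_sub bp.integrable bn.integrable, ← hmean]
    rw [hsub]
    rfl
  have ip : ∫ x, hp x = I / 2 := by linarith
  have iN : ∫ x, hn x = I / 2 := by linarith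
  have lp := hlow n hp v bp (fun x => le_max_right _ _) (by rw [ip]; linarith)
  have ln := hlow n hn v bn (fun x => le_max_right _ _) (by rw [iN]; linarith)
  rw [ip] at lp
  rw [iN] at ln
  have cp := (H.iterOp_bv_abs hθ1 hD n m bp).1
  have cn := (H.iterOp_bv_abs hθ1 hD n m bn).1
  have c := (H.iterOp_bv_abs hθ1 hD n m hv).1
  have hpt : ∀ x, |iterOp L n m h x| ≤ iterOp L n m hp x + iterOp L n m hn x - ε * I := by
    intro x
    have e : iterOp L n m h x = iterOp L n m hp x - iterOp L n m hn x := by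
      conv_lhs => rw [hsub]
      rw [map_sub]
      rfl
    rw [e, _root_.abs_le]
    constructor <;> linarith [lp x, ln x]
  calc ∫ x, |iterOp L n m h x|
      ≤ ∫ x, (iterOp L n m hp x + iterOp L n m hn x - ε * I) :=
        integral_mono c.integrable.abs
          ((cp.integrable.add cn.integrable).sub (integrable_const _)) hpt
    _ = (∫ x, hp x) + (∫ x, hn x) - ε * I := by
        have e1 := integral_sub (cp.integrable.add cn.integrable) (integrable_const (ε * I))
        simp only [Pi.add_apply] at e1
        rw [e1, integral_add cp.integrable cn.integrable, H.integral_iterOp hθ1 hD n m bp,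
          H.integral_iterOp hθ1 hD n m bn]
        simp
    _ = (1 - ε) * I := by rw [← i1]; ring

/-- Uniform positivity of densities and exponential decay of correlations, with constants that do
not depend on the size of the gates. -/
lemma exists_decay {θ D K : ℝ} (hθ0 : 0 ≤ θ) (hθ1 : θ < 1) (hD : 0 ≤ D) (hK : 1 ≤ K) :
    ∃ δ₁ b C μ : ℝ, 0 < δ₁ ∧ 0 < b ∧ 0 < C ∧ 0 < μ ∧ μ < 1 ∧
      ∀ (δ : ℝ) (T G : ℤ → Torus → Torus) (W : ℤ → Set Torus)
        (L : ℤ → (Torus → ℝ) →ₗ[ℝ] (Torus → ℝ)), TransferSystem θ D K δ T G W L → δ ≤ δ₁ →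
        (∀ (n : ℤ) (k : ℕ) (x : Torus), b ≤ iterOp L n k (fun _ => 1) x) ∧
        ∀ (n : ℤ) (k : ℕ) (h : Torus → ℝ) (v : ℝ), BVBound h v → ∫ x, h x = 0 →
          ∀ x, |iterOp L n k h x| ≤ C * μ ^ k * (v + ∫ y, |h y|) := by
  have hθ : 0 < 1 - θ := by linarith
  set D' : ℝ := D / (1 - θ) with hD'
  have hD'0 : 0 ≤ D' := by positivity
  -- `B` separates two regimes. For `v ≤ B * I` the L¹ norm contracts. For `v > B * I` the variation
  -- dominates, and `(1 - θ) / 2 * B = D' + 1` leaves a gain of `I` to spare.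
  set B : ℝ := 2 * (D' + 1) / (1 - θ) with hB
  have hB0 : 0 < B := by positivity
  have hBD : D' ≤ 2 * B := by
    have : D' + 1 ≤ B := by
      rw [hB, le_div_iff₀ hθ]
      nlinarith
    linarith
  obtain ⟨m, ε, δ₁, hm, hε, hε1, hεK, hδ₁, hδ₁', hlow⟩ :=
    exists_uniform_lower_bound (B := 2 * B) hK
  -- `B'` is the weight in the adapted norm `v + B' * ∫ |h|`. With `2 * D' ≤ ε * B'`, half of the L¹
  -- contraction absorbs the variation created in a block.
  set B' : ℝ := 2 * D' / ε + 1 with hB'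
  have hB'1 : 1 ≤ B' := by
    have : 0 ≤ 2 * D' / ε := by positivity
    linarith
  have hB'0 : 0 < B' := by linarith
  have hB'ε : 2 * D' ≤ ε * B' := by
    have : ε * B' = 2 * D' + ε := by
      rw [hB']
      field_simp
    linarith
  have hB'D : D' ≤ B' := by nlinarith
  set ρ : ℝ := max ((1 + θ) / 2) (max (1 - ε / 2) (1 - 1 / B')) with hρ
  have hρθ : (1 + θ) / 2 ≤ ρ := le_max_left _ _
  have hρε : 1 - ε / 2 ≤ ρ := (le_max_left _ _).trans (le_max_right _ _)
  have hρB : 1 - 1 / B' ≤ ρ := (le_max_right _ _).trans (le_max_right _ _)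
  have hρ1 : ρ < 1 := by
    refine max_lt (by linarith) (max_lt (by linarith) ?_)
    have : 0 < 1 / B' := by positivity
    linarith
  have hρ0 : 0 < ρ := by linarith
  have hρB' : (1 - ρ) * B' ≤ 1 := by
    have : (1 - ρ) * B' ≤ 1 / B' * B' := mul_le_mul_of_nonneg_right (by linarith) hB'0.le
    rwa [one_div_mul_cancel hB'0.ne'] at this
  have hm' : (1 : ℝ) ≤ m := by exact_mod_cast hm
  -- Bernoulli's inequality gives `ρ ≤ μ ^ m`, so `μ` serves as a rate per step.
  set μ : ℝ := 1 - (1 - ρ) / m with hμ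
  have hq : (1 - ρ) / m ≤ 1 - ρ := div_le_self (by linarith) hm'
  have hq0 : 0 < (1 - ρ) / m := div_pos (by linarith) (by linarith)
  have hμ0 : 0 < μ := by linarith
  have hμ1 : μ < 1 := by linarith
  have hρμ : ρ ≤ μ ^ m := by
    have h1 := one_add_mul_le_pow (a := -((1 - ρ) / m)) (by linarith) m
    have h2 : (1 : ℝ) + m * -((1 - ρ) / m) = ρ := by
      field_simp
      ring
    rw [h2, ← sub_eq_add_neg] at h1
    exact h1
  refine ⟨δ₁, ε, 2 * B' / μ ^ m, μ, hδ₁, hε, by positivity, hμ0, hμ1, ?_⟩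
  intro δ T G W L H hδ
  have hlow' := hlow θ D δ T G W L H hδ
  have hK0 : 0 < K := by linarith
  constructor
  · intro n k x
    have h1 : BVBound (fun _ : Torus => (1 : ℝ)) 0 := BVBound.const 1
    have hint : ∫ _ : Torus, (1 : ℝ) = 1 := by simp
    -- Before time `m` the crude bound `K⁻ᵏ` suffices. Later, the last `m` steps act on a density of
    -- integral one and variation at most `D' ≤ 2 * B`.
    rcases lt_or_ge k m with hk | hk
    · have h2 := H.lower_bound_iterOp hK0 (by linarith) n k zero_le_one (h := fun _ => 1)
        (fun _ => le_rfl) x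
      refine (hεK.trans ?_).trans h2
      exact one_div_le_one_div_of_le (by positivity) (pow_le_pow_right₀ hK hk.le)
    · obtain ⟨j, rfl⟩ := Nat.exists_eq_add_of_le' hk
      rw [iterOp_add]
      have h2 := (H.iterOp_bv_abs hθ1 hD n j h1).1
      have h3 := H.integral_iterOp hθ1 hD n j h1
      simp only [abs_one, hint, mul_one, mul_zero, zero_add] at h2 h3
      have h4 := hlow' (n + j) _ _ h2 (H.iterOp_nonneg n j fun _ => zero_le_one)
        (by rw [h3]; linarith) x
      rwa [h3, mul_one] at h4
  · intro n k h v hv hmean x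
    have hblock : ∀ (n : ℤ) (h : Torus → ℝ) (v : ℝ), BVBound h v → ∫ x, h x = 0 →
        ∃ v', BVBound (iterOp L n m h) v' ∧
          v' + B' * ∫ x, |iterOp L n m h x| ≤ ρ * (v + B' * ∫ x, |h x|) := by
      intro n h v hv hmean
      obtain ⟨c1, c2⟩ := H.iterOp_bv_abs hθ1 hD n m hv
      have hI := BVBound.integral_abs_nonneg h
      have hv0 := hv.nonneg
      refine ⟨_, c1, ?_⟩
      have hθm : θ ^ m * v ≤ θ * v :=
        mul_le_mul_of_nonneg_right (pow_le_of_le_one hθ0 hθ1.le hm.ne') hv0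
      rw [← hD']
      set I := ∫ x, |h x|
      rcases le_or_gt v (B * I) with hcase | hcase
      · have h1 := H.integral_abs_iterOp_le_of_lower_bound hθ1 hD hlow' n hv hmean hcase
        have h2 := mul_le_mul_of_nonneg_left h1 hB'0.le
        have h3 := mul_le_mul_of_nonneg_right hB'ε hI
        have h4 := mul_le_mul_of_nonneg_right hρε (mul_nonneg hB'0.le hI)
        have h5 := mul_le_mul_of_nonneg_right (by linarith : θ ≤ ρ) hv0
        nlinarith
      · have h1 := mul_le_mul_of_nonneg_left c2 hB'0.le
        have h2 : (1 - θ) / 2 * (B * I) ≤ (1 - θ) / 2 * v :=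
          mul_le_mul_of_nonneg_left hcase.le (by linarith)
        have h3 : (1 - θ) / 2 * (B * I) = (D' + 1) * I := by
          rw [hB]
          field_simp
        have h4 := mul_le_mul_of_nonneg_right hρB' hI
        have h5 := mul_le_mul_of_nonneg_right hρθ hv0
        nlinarith
    have hiter : ∀ q : ℕ, ∃ v', BVBound (iterOp L n (m * q) h) v' ∧
        v' + B' * ∫ x, |iterOp L n (m * q) h x| ≤ ρ ^ q * (v + B' * ∫ x, |h x|) := by
      intro q
      induction q with
      | zero => exact ⟨v, hv, by simp [iterOp]⟩
      | succ q ih =>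
        obtain ⟨v', b', l'⟩ := ih
        obtain ⟨v'', b'', l''⟩ := hblock (n + (m * q : ℕ)) _ v' b'
          (by rw [H.integral_iterOp hθ1 hD n _ hv, hmean])
        rw [← iterOp_add] at b''
        simp only [← iterOp_add] at l''
        refine ⟨v'', b'', l''.trans ?_⟩
        rw [pow_succ', mul_assoc]
        exact mul_le_mul_of_nonneg_left l' hρ0.le
    obtain ⟨v', b', l'⟩ := hiter (k / m)
    -- The remaining `k % m < m` steps only use boundedness; they cost the factor `1 / μ ^ m` in the
    -- constant.
    have hk : m * (k / m) + k % m = k := Nat.div_add_mod k m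
    obtain ⟨c1, c2⟩ := H.iterOp_bv_abs hθ1 hD (n + (m * (k / m) : ℕ)) (k % m) b'
    rw [← iterOp_add, hk, ← hD'] at c1
    simp only [← iterOp_add, hk] at c2
    have hI := BVBound.integral_abs_nonneg h
    have hv0 := hv.nonneg
    have hv'0 := b'.nonneg
    have h1 := c1.abs_le x
    have h2 : θ ^ (k % m) * v' ≤ v' :=
      mul_le_of_le_one_left hv'0 (pow_le_one₀ hθ0 hθ1.le)
    set J := ∫ x, |iterOp L n (m * (k / m)) h x| with hJ
    have hJ0 : 0 ≤ J := BVBound.integral_abs_nonneg _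
    set I := ∫ x, |h x|
    have h3 : |iterOp L n k h x| ≤ 2 * (v' + B' * J) := by
      have e1 := mul_le_mul_of_nonneg_right hB'D hJ0
      have e2 := mul_le_mul_of_nonneg_right hB'1 hJ0
      have e3 := mul_nonneg hB'0.le hJ0
      linarith
    have h4 : v + B' * I ≤ B' * (v + I) := by
      have := mul_le_mul_of_nonneg_right hB'1 hv0
      linarith
    have h5 : ρ ^ (k / m) * μ ^ m ≤ μ ^ k := by
      calc ρ ^ (k / m) * μ ^ m ≤ (μ ^ m) ^ (k / m) * μ ^ (k % m) := by
            refine mul_le_mul (pow_le_pow_left₀ hρ0.le hρμ _) ?_ (by positivity) (by positivity)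
            exact pow_le_pow_of_le_one hμ0.le hμ1.le (Nat.mod_lt _ hm).le
        _ = μ ^ k := by rw [← pow_mul, ← pow_add, hk]
    have h6 : ρ ^ (k / m) ≤ μ ^ k / μ ^ m := by
      rw [le_div_iff₀ (by positivity)]
      exact h5
    calc |iterOp L n k h x| ≤ 2 * (ρ ^ (k / m) * (v + B' * I)) := h3.trans (by linarith)
      _ ≤ 2 * (μ ^ k / μ ^ m * (B' * (v + I))) := by
          refine mul_le_mul_of_nonneg_left (mul_le_mul h6 h4 ?_ ?_) (by norm_num)
          · positivity
          · positivity
      _ = _ := by ring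

end TransferSystem

/-! ### The variance of the number of visits to small arcs -/

lemma sum_pow_le_of_injOn {ν : ℝ} (hν0 : 0 ≤ ν) (hν1 : ν < 1) (F : Finset ℕ) (g : ℕ → ℕ)
    (hg : Set.InjOn g F) : ∑ j ∈ F, ν ^ g j ≤ (1 - ν)⁻¹ := by
  rw [← Finset.sum_image (f := fun k => ν ^ k) hg, ← tsum_geometric_of_lt_one hν0 hν1]
  exact (summable_geometric_of_lt_one hν0 hν1).sum_le_tsum _ fun _ _ => by positivity

/-- A double sum with large diagonal and exponentially small negative part off the diagonal. -/
lemma le_sum_sum_of_diagonal {a : ℕ → ℕ → ℝ} {α β ν : ℝ} (hν0 : 0 ≤ ν) (hν1 : ν < 1)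
    (hβ : 0 ≤ β) (hsymm : ∀ i j, a i j = a j i) (hdiag : ∀ i, α ≤ a i i)
    (hoff : ∀ i j, i < j → -(β * ν ^ (j - i)) ≤ a i j) (F : Finset ℕ) :
    (α - 2 * β * (1 - ν)⁻¹) * F.card ≤ ∑ i ∈ F, ∑ j ∈ F, a i j := by
  have hrow : ∀ i ∈ F, α - 2 * β * (1 - ν)⁻¹ ≤ ∑ j ∈ F, a i j := by
    intro i hi
    rw [← Finset.add_sum_erase F _ hi]
    have hsplit := Finset.sum_filter_add_sum_filter_not (F.erase i) (fun j => i < j) (a i)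
    have h1 : -(β * (1 - ν)⁻¹) ≤ ∑ j ∈ (F.erase i).filter (fun j => i < j), a i j := by
      have h2 := sum_pow_le_of_injOn hν0 hν1 ((F.erase i).filter fun j => i < j) (fun j => j - i)
        (by
          intro x hx y hy hxy
          have hx' := (Finset.mem_filter.1 (Finset.mem_coe.1 hx)).2
          have hy' := (Finset.mem_filter.1 (Finset.mem_coe.1 hy)).2
          simp only at hxy
          omega)
      calc -(β * (1 - ν)⁻¹) ≤
            -(β * ∑ j ∈ (F.erase i).filter (fun j => i < j), ν ^ (j - i)) :=
            neg_le_neg (mul_le_mul_of_nonneg_left h2 hβ)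
        _ = ∑ j ∈ (F.erase i).filter (fun j => i < j), -(β * ν ^ (j - i)) := by
            rw [Finset.sum_neg_distrib, Finset.mul_sum]
        _ ≤ _ := Finset.sum_le_sum fun j hj => hoff i j (Finset.mem_filter.1 hj).2
    have h3 : -(β * (1 - ν)⁻¹) ≤ ∑ j ∈ (F.erase i).filter (fun j => ¬ i < j), a i j := by
      have hlt : ∀ j ∈ (F.erase i).filter (fun j => ¬ i < j), j < i := by
        intro j hj
        have h4 := Finset.mem_filter.1 hj
        have h5 := Finset.ne_of_mem_erase h4.1
        omega
      have h2 := sum_pow_le_of_injOn hν0 hν1 ((F.erase i).filter fun j => ¬ i < j)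
        (fun j => i - j)
        (by
          intro x hx y hy hxy
          have hx' := hlt x hx
          have hy' := hlt y hy
          simp only at hxy
          omega)
      calc -(β * (1 - ν)⁻¹) ≤
            -(β * ∑ j ∈ (F.erase i).filter (fun j => ¬ i < j), ν ^ (i - j)) :=
            neg_le_neg (mul_le_mul_of_nonneg_left h2 hβ)
        _ = ∑ j ∈ (F.erase i).filter (fun j => ¬ i < j), -(β * ν ^ (i - j)) := by
            rw [Finset.sum_neg_distrib, Finset.mul_sum]
        _ ≤ _ := Finset.sum_le_sum fun j hj => by
            rw [hsymm]
            exact hoff j i (hlt j hj)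
    have := hdiag i
    linarith
  calc _ = ∑ i ∈ F, (α - 2 * β * (1 - ν)⁻¹) := by
        rw [Finset.sum_const, nsmul_eq_mul, mul_comm]
    _ ≤ _ := Finset.sum_le_sum hrow

lemma indicator_one_apply_mem (U : Set Torus) (x : Torus) :
    0 ≤ U.indicator (1 : Torus → ℝ) x ∧ U.indicator (1 : Torus → ℝ) x ≤ 1 ∧
      U.indicator (1 : Torus → ℝ) x ^ 2 = U.indicator (1 : Torus → ℝ) x := by
  by_cases hx : x ∈ U <;> simp [hx]

namespace TransferSystem

/-- The variance of the number of visits to arcs of measure comparable to a small `δ` grows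
linearly. -/
lemma exists_variance_lower_bound {θ D K c : ℝ} (hθ0 : 0 ≤ θ) (hθ1 : θ < 1) (hD : 0 ≤ D)
    (hK : 1 ≤ K) (hc : 0 < c) :
    ∃ δ₂ κ : ℝ, 0 < δ₂ ∧ δ₂ < 1 ∧ 0 < κ ∧
      ∀ (δ : ℝ) (T G : ℤ → Torus → Torus) (W : ℤ → Set Torus)
        (L : ℤ → (Torus → ℝ) →ₗ[ℝ] (Torus → ℝ)), TransferSystem θ D K δ T G W L → δ ≤ δ₂ →
        ∀ (s : ℤ) (U : ℕ → Set Torus), (∀ i, IsArc (U i)) → (∀ i, volume.real (U i) ≤ δ) →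
          (∀ i, c * δ ≤ volume.real (U i)) → ∀ F : Finset ℕ,
          κ * δ * F.card ≤ ∫ x, (∑ i ∈ F, ((U i).indicator (1 : Torus → ℝ) (compFrom G s i x) -
            ∫ y, (U i).indicator (1 : Torus → ℝ) (compFrom G s i y))) ^ 2 := by
  obtain ⟨δ₁, b, C, μ, hδ₁, hb, hC, hμ0, hμ1, hdecay⟩ := exists_decay hθ0 hθ1 hD hK
  have hθ : 0 < 1 - θ := by linarith
  set D' : ℝ := D / (1 - θ) with hD'
  have hD'0 : 0 ≤ D' := by positivity
  set A : ℝ := D' + 1 with hA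
  have hA1 : 1 ≤ A := by linarith
  have hA0 : 0 < A := by linarith
  set E : ℝ := Real.sqrt (6 * A ^ 3 * C) with hE
  have hE0 : 0 ≤ E := Real.sqrt_nonneg _
  set ν : ℝ := Real.sqrt μ with hν
  have hν0 : 0 ≤ ν := Real.sqrt_nonneg _
  have hν1 : ν < 1 := by
    rw [hν, Real.sqrt_lt' one_pos]
    linarith
  have hν' : 0 < 1 - ν := by linarith
  -- Chosen so that `√δ ≤ η` forces `E * √δ / (1 - ν) ≤ b * c / 8`: the off-diagonal part then takes
  -- at most half of the diagonal `b * c * δ / 2`.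
  set η : ℝ := b * c * (1 - ν) / (8 * (E + 1)) with hη
  have hη0 : 0 < η := by positivity
  refine ⟨min δ₁ (min (1 / (2 * A)) (η ^ 2)), b * c / 4, by positivity, ?_, by positivity, ?_⟩
  · refine (min_le_right _ _).trans_lt ((min_le_left _ _).trans_lt ?_)
    rw [div_lt_one (by positivity)]
    linarith
  intro δ T G W L H hδ s U hU hUδ hUc F
  have hδ0 := H.pos
  have hδ₁' : δ ≤ δ₁ := hδ.trans (min_le_left _ _)
  have hAδ : A * δ ≤ 1 / 2 := by
    have h1 : δ ≤ 1 / (2 * A) := hδ.trans ((min_le_right _ _).trans (min_le_left _ _))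
    rw [le_div_iff₀ (by positivity)] at h1
    linarith
  have hδη : Real.sqrt δ ≤ η := by
    rw [Real.sqrt_le_left hη0.le]
    exact hδ.trans ((min_le_right _ _).trans (min_le_right _ _))
  have hδ1 : δ < 1 := by nlinarith
  obtain ⟨hlow, hdec⟩ := hdecay δ T G W L H hδ₁'
  set χ : ℕ → Torus → ℝ := fun i => (U i).indicator 1 with hχ
  have hUm : ∀ i, MeasurableSet (U i) := fun i => (hU i).measurableSet ((hUδ i).trans_lt hδ1)
  have hχb : ∀ i, BVBound (χ i) 2 := fun i => (hU i).bvBound_indicator ((hUδ i).trans_lt hδ1)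
  have hχ0 : ∀ i x, 0 ≤ χ i x := fun i x => (indicator_one_apply_mem (U i) x).1
  have hχ1 : ∀ i x, χ i x ≤ 1 := fun i x => (indicator_one_apply_mem (U i) x).2.1
  have hχ2 : ∀ i x, χ i x ^ 2 = χ i x := fun i x => (indicator_one_apply_mem (U i) x).2.2
  have hχabs : ∀ i x, |χ i x| ≤ 1 := fun i x => by rw [abs_of_nonneg (hχ0 i x)]; exact hχ1 i x
  have hχint : ∀ i, ∫ x, χ i x = volume.real (U i) := fun i => by
    simp only [hχ]
    rw [integral_indicator_one (hUm i)]
  -- `d i` is the density of the state at time `i` for a uniform start.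
  set d : ℕ → Torus → ℝ := fun i => iterOp L s i (fun _ => 1) with hd
  have hd_bv : ∀ i, BVBound (d i) D' := by
    intro i
    have := (H.iterOp_bv_abs hθ1 hD s i (BVBound.const 1)).1
    simpa using this
  have hd0 : ∀ i x, 0 ≤ d i x := fun i => H.iterOp_nonneg s i fun _ => zero_le_one
  have hd_int : ∀ i, ∫ x, d i x = 1 := by
    intro i
    simp only [hd]
    rw [H.integral_iterOp hθ1 hD s i (BVBound.const 1)]
    simp
  have hd_abs : ∀ i x, |d i x| ≤ A := by
    intro i x
    have h1 := (hd_bv i).abs_le x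
    have h2 : ∫ y, |d i y| = 1 := by
      simp only [abs_of_nonneg (hd0 i _)]
      exact hd_int i
    rw [h2] at h1
    linarith
  have hd_le : ∀ i x, d i x ≤ A := fun i x => (le_abs_self _).trans (hd_abs i x)
  have hX : ∀ i (g : Torus → ℝ), Measurable g → (∀ x, |g x| ≤ 1) →
      ∫ x, g (compFrom G s i x) = ∫ x, d i x * g x := by
    intro i g hg hg1
    have := H.iterOp_dual hθ1 hD s i (BVBound.const 1) hg hg1
    simpa using this.symm
  set X : ℕ → Torus → ℝ := fun i x => χ i (compFrom G s i x) with hXdef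
  have hXm : ∀ i, Measurable (X i) := fun i =>
    (hχb i).measurable.comp (H.measurable_compFrom s i)
  have hXabs : ∀ i x, |X i x| ≤ 1 := fun i x => hχabs i _
  have hXint : ∀ i, Integrable (X i) := fun i => integrable_of_abs_le (hXm i) (hXabs i)
  set p : ℕ → ℝ := fun i => ∫ x, X i x with hp
  have hp_eq : ∀ i, p i = ∫ x, d i x * χ i x := fun i => hX i _ (hχb i).measurable (hχabs i)
  have hdχ : ∀ i, BVBound (d i * χ i) (D' + 2 * A) := fun i => by
    have := (hd_bv i).mul (hχb i) (hd_abs i) (hχabs i)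
    convert this using 1
    ring
  have hp_le : ∀ i, p i ≤ A * δ := by
    intro i
    rw [hp_eq]
    calc ∫ x, d i x * χ i x ≤ ∫ x, A * χ i x :=
          integral_mono (hdχ i).integrable ((hχb i).integrable.const_mul A)
            fun x => mul_le_mul_of_nonneg_right (hd_le i x) (hχ0 i x)
      _ = A * volume.real (U i) := by rw [integral_const_mul, hχint]
      _ ≤ A * δ := mul_le_mul_of_nonneg_left (hUδ i) hA0.le
  have hp_ge : ∀ i, b * (c * δ) ≤ p i := by
    intro i
    rw [hp_eq]
    calc b * (c * δ) ≤ b * volume.real (U i) := mul_le_mul_of_nonneg_left (hUc i) hb.le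
      _ = ∫ x, b * χ i x := by rw [integral_const_mul, hχint]
      _ ≤ _ := integral_mono ((hχb i).integrable.const_mul b) (hdχ i).integrable
            fun x => mul_le_mul_of_nonneg_right (hlow s i x) (hχ0 i x)
  have hp0 : ∀ i, 0 ≤ p i := fun i => (by positivity : 0 ≤ b * (c * δ)).trans (hp_ge i)
  have hp1 : ∀ i, p i ≤ 1 := fun i => (hp_le i).trans (by linarith)
  have hXX : ∀ i j, Integrable (fun x => X i x * X j x) := fun i j =>
    integrable_of_abs_le (a := 1) ((hXm i).mul (hXm j)) fun x => by
      rw [abs_mul]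
      exact mul_le_one₀ (hXabs i x) (abs_nonneg _) (hXabs j x)
  have hcov : ∀ i j, ∫ x, (X i x - p i) * (X j x - p j) = (∫ x, X i x * X j x) - p i * p j := by
    intro i j
    have e : ∀ x, (X i x - p i) * (X j x - p j) =
        X i x * X j x - (p i * X j x + (p j * X i x - p i * p j)) := fun x => by ring
    simp only [e]
    have i1 : Integrable fun x => p i * X j x := (hXint j).const_mul _
    have i2 : Integrable fun x => p j * X i x := (hXint i).const_mul _
    have i3 : Integrable fun x => p j * X i x - p i * p j := i2.sub (integrable_const _)
    have i4 : Integrable fun x => p i * X j x + (p j * X i x - p i * p j) := i1.add i3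
    rw [integral_sub (hXX i j) i4, integral_add i1 i3, integral_sub i2 (integrable_const _),
      integral_const_mul, integral_const_mul]
    simp only [integral_const, smul_eq_mul, measureReal_def, UnitAddCircle.measure_univ,
      ENNReal.toReal_one, one_mul]
    change _ - (p i * p j + (p j * p i - p i * p j)) = _
    ring
  set a : ℕ → ℕ → ℝ := fun i j => ∫ x, (X i x - p i) * (X j x - p j) with ha
  have hdiag : ∀ i, b * c * δ / 2 ≤ a i i := by
    intro i
    have h1 : a i i = p i - p i * p i := by
      simp only [ha]
      rw [hcov]
      congr 1
      simp only [hp]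
      congr 1
      funext x
      rw [← sq]
      exact hχ2 i _
    rw [h1]
    have h2 : p i ≤ 1 / 2 := (hp_le i).trans hAδ
    have h3 := hp_ge i
    have h4 := mul_le_mul_of_nonneg_left h2 (hp0 i)
    linarith
  have hoff : ∀ i j, i < j → -(δ * (E * Real.sqrt δ) * ν ^ (j - i)) ≤ a i j := by
    intro i j hij
    obtain ⟨k, rfl⟩ := Nat.exists_eq_add_of_le hij.le
    rw [Nat.add_sub_cancel_left]
    have hlow1 : -(A ^ 2 * δ ^ 2) ≤ a i (i + k) := by
      simp only [ha]
      rw [hcov]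
      have h1 : 0 ≤ ∫ x, X i x * X (i + k) x :=
        integral_nonneg fun x => mul_nonneg (hχ0 _ _) (hχ0 _ _)
      have h2 := mul_le_mul (hp_le i) (hp_le (i + k)) (hp0 _) (by positivity)
      nlinarith
    -- The covariance is the integral over `U (i + k)` of the `k`-step image of the mean-zero
    -- function `f = d i * (χ i - p i)`. The image decays pointwise, and the arc supplies the factor
    -- `δ`.
    have hlow2 : -(6 * A * C * μ ^ k * δ) ≤ a i (i + k) := by
      set f : Torus → ℝ := d i * χ i - p i • d i with hf
      have hfb : BVBound f (D' + 2 * A + |p i| * D') := (hdχ i).sub ((hd_bv i).smul (p i))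
      have hfmean : ∫ x, f x = 0 := by
        simp only [hf, Pi.sub_apply, Pi.mul_apply, Pi.smul_apply, smul_eq_mul]
        have e1 : Integrable fun x => d i x * χ i x := (hdχ i).integrable
        rw [integral_sub e1 ((hd_bv i).integrable.const_mul _), integral_const_mul, hd_int,
          ← hp_eq]
        ring
      have hfabs : ∀ x, |f x| ≤ 2 * A := by
        intro x
        simp only [hf, Pi.sub_apply, Pi.mul_apply, Pi.smul_apply, smul_eq_mul]
        have e1 : |d i x * χ i x| ≤ A * 1 := by
          rw [abs_mul]
          exact mul_le_mul (hd_abs i x) (hχabs i x) (abs_nonneg _) hA0.le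
        have e2 : |p i * d i x| ≤ 1 * A := by
          rw [abs_mul, abs_of_nonneg (hp0 i)]
          exact mul_le_mul (hp1 i) (hd_abs i x) (abs_nonneg _) zero_le_one
        have e3 := abs_sub (d i x * χ i x) (p i * d i x)
        linarith
      have hfI : ∫ x, |f x| ≤ 2 * A := by
        have := integral_mono hfb.integrable.abs (integrable_const (2 * A)) hfabs
        simpa using this
      have hQ : D' + 2 * A + |p i| * D' + ∫ x, |f x| ≤ 6 * A := by
        rw [abs_of_nonneg (hp0 i)]
        have := mul_le_mul_of_nonneg_right (hp1 i) hD'0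
        linarith
      have hpt : ∀ x, |iterOp L (s + i) k f x| ≤ 6 * A * C * μ ^ k := by
        intro x
        refine (hdec (s + i) k f _ hfb hfmean x).trans ?_
        calc _ ≤ C * μ ^ k * (6 * A) := mul_le_mul_of_nonneg_left hQ (by positivity)
          _ = _ := by ring
      have hcoveq : a i (i + k) = ∫ x, iterOp L (s + i) k f x * χ (i + k) x := by
        simp only [ha]
        rw [hcov]
        have e1 : ∫ x, X i x * X (i + k) x =
            ∫ x, d i x * (χ i x * χ (i + k) (compFrom G (s + i) k x)) := by
          rw [← hX i (fun x => χ i x * χ (i + k) (compFrom G (s + i) k x))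
            ((hχb i).measurable.mul
              ((hχb (i + k)).measurable.comp (H.measurable_compFrom _ _)))
            (fun x => by
              rw [abs_mul]
              exact mul_le_one₀ (hχabs _ _) (abs_nonneg _) (hχabs _ _))]
          simp only [hXdef, compFrom_add]
        have e2 : p (i + k) = ∫ x, d i x * χ (i + k) (compFrom G (s + i) k x) := by
          rw [← hX i (fun x => χ (i + k) (compFrom G (s + i) k x))
            ((hχb (i + k)).measurable.comp (H.measurable_compFrom _ _)) (fun x => hχabs _ _)]
          simp only [hp, hXdef, compFrom_add]
        rw [H.iterOp_dual hθ1 hD (s + i) k hfb (hχb (i + k)).measurable (hχabs _), e1, e2,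
          ← integral_const_mul, ← integral_sub]
        · congr 1
          funext x
          simp only [hf, Pi.sub_apply, Pi.mul_apply, Pi.smul_apply, smul_eq_mul]
          ring
        · refine integrable_of_abs_le (a := A * (1 * 1)) ((hd_bv i).measurable.mul
            ((hχb i).measurable.mul ((hχb (i + k)).measurable.comp (H.measurable_compFrom _ _))))
            fun x => ?_
          simp only [abs_mul]
          exact mul_le_mul (hd_abs i x)
            (mul_le_mul (hχabs _ _) (hχabs _ _) (abs_nonneg _) zero_le_one) (by positivity) hA0.le
        · refine Integrable.const_mul ?_ _
          refine integrable_of_abs_le (a := A * 1) ((hd_bv i).measurable.mul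
            ((hχb (i + k)).measurable.comp (H.measurable_compFrom _ _))) fun x => ?_
          simp only [abs_mul]
          exact mul_le_mul (hd_abs i x) (hχabs _ _) (abs_nonneg _) hA0.le
      rw [hcoveq]
      have hbv := (H.iterOp_bv_abs hθ1 hD (s + i) k hfb).1
      have hCμ : 0 ≤ 6 * A * C * μ ^ k := by positivity
      calc -(6 * A * C * μ ^ k * δ) ≤ -(6 * A * C * μ ^ k * volume.real (U (i + k))) :=
            neg_le_neg (mul_le_mul_of_nonneg_left (hUδ _) hCμ)
        _ = ∫ x, -(6 * A * C * μ ^ k) * χ (i + k) x := by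
            rw [integral_const_mul, hχint]
            ring
        _ ≤ _ := integral_mono ((hχb _).integrable.const_mul _)
            (hbv.integrable.mul_bdd (c := 1) (hχb (i + k)).measurable.aestronglyMeasurable
              (Filter.Eventually.of_forall (hχabs _)))
            fun x => mul_le_mul_of_nonneg_right (abs_le.1 (hpt x)).1 (hχ0 _ _)
    -- The target bound is the geometric mean of the two bounds. If `-a i (i + k)` exceeded it, its
    -- square would exceed their product.
    have hsq : (δ * (E * Real.sqrt δ) * ν ^ k) ^ 2 =
        (A ^ 2 * δ ^ 2) * (6 * A * C * μ ^ k * δ) := by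
      have e1 : E ^ 2 = 6 * A ^ 3 * C := Real.sq_sqrt (by positivity)
      have e2 : Real.sqrt δ ^ 2 = δ := Real.sq_sqrt hδ0.le
      have e3 : (ν ^ k) ^ 2 = μ ^ k := by
        rw [← pow_mul, mul_comm, pow_mul, hν, Real.sq_sqrt hμ0.le]
      calc _ = δ ^ 2 * (E ^ 2 * Real.sqrt δ ^ 2) * (ν ^ k) ^ 2 := by ring
        _ = _ := by rw [e1, e2, e3]; ring
    by_contra hcon
    push Not at hcon
    have hz : 0 ≤ δ * (E * Real.sqrt δ) * ν ^ k := by positivity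
    have h1 : (δ * (E * Real.sqrt δ) * ν ^ k) ^ 2 < (-a i (i + k)) ^ 2 :=
      pow_lt_pow_left₀ (by linarith) hz two_ne_zero
    rw [hsq, sq (-a i (i + k))] at h1
    have h2 : -a i (i + k) * -a i (i + k) ≤ (A ^ 2 * δ ^ 2) * (6 * A * C * μ ^ k * δ) :=
      mul_le_mul (by linarith) (by linarith) (by linarith) (by positivity)
    linarith
  have hmain := le_sum_sum_of_diagonal (a := a) hν0 hν1
    (by positivity : 0 ≤ δ * (E * Real.sqrt δ))
    (fun i j => by simp only [ha]; congr 1; funext x; ring) hdiag hoff F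
  have hexp : ∫ x, (∑ i ∈ F, (X i x - p i)) ^ 2 = ∑ i ∈ F, ∑ j ∈ F, a i j := by
    have hXXp : ∀ i j, Integrable fun x => (X i x - p i) * (X j x - p j) := fun i j =>
      integrable_of_abs_le (a := 2 * 2)
        (((hXm i).sub_const _).mul ((hXm j).sub_const _)) fun x => by
          rw [abs_mul]
          have hb2 : ∀ i, |X i x - p i| ≤ 2 := fun i => by
            have e1 := abs_sub (X i x) (p i)
            have e2 := hXabs i x
            have e3 := hp1 i
            rw [abs_of_nonneg (hp0 i)] at e1
            linarith
          exact mul_le_mul (hb2 i) (hb2 j) (abs_nonneg _) (by norm_num)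
    simp only [sq, Finset.sum_mul_sum]
    rw [integral_finsetSum _ fun i _ => integrable_finsetSum _ fun j _ => hXXp i j]
    exact Finset.sum_congr rfl fun i _ => integral_finsetSum _ fun j _ => hXXp i j
  change b * c / 4 * δ * F.card ≤ ∫ x, (∑ i ∈ F, (X i x - p i)) ^ 2
  rw [hexp]
  refine le_trans (mul_le_mul_of_nonneg_right ?_ (Nat.cast_nonneg _)) hmain
  have h1 : E * Real.sqrt δ * (1 - ν)⁻¹ ≤ b * c / 8 := by
    rw [← div_eq_mul_inv, div_le_iff₀ hν']
    calc E * Real.sqrt δ ≤ (E + 1) * η :=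
          mul_le_mul (by linarith) hδη (Real.sqrt_nonneg _) (by linarith)
      _ = b * c / 8 * (1 - ν) := by
          rw [hη]
          field_simp
  have h2 := mul_le_mul_of_nonneg_left h1 hδ0.le
  linarith

end TransferSystem

/-! ### The walk and its hitting times -/

lemma hittingTime_eq {T : ℤ → Torus → Torus} {W : ℤ → Set Torus} {n k : ℤ} {x : Torus} {m : ℕ}
    (hm : ((walk T W)^[m] (x, k)).2 = n) (hlt : ∀ t < m, ((walk T W)^[t] (x, k)).2 ≠ n) :
    hittingTime T W n x k = m := by
  refine le_antisymm (Nat.sInf_le hm) ?_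
  by_contra hcon
  push Not at hcon
  exact hlt _ hcon (Nat.sInf_mem (s := {t : ℕ | ((walk T W)^[t] (x, k)).2 = n}) ⟨m, hm⟩)

lemma walk_of_mem {T : ℤ → Torus → Torus} {W : ℤ → Set Torus} {x : Torus} {k : ℤ}
    (hx : x ∈ W k) : walk T W (x, k) = (T k x, k - 1) := by
  simp [walk, hx]

lemma walk_of_notMem {T : ℤ → Torus → Torus} {W : ℤ → Set Torus} {x : Torus} {k : ℤ}
    (hx : x ∉ W k) : walk T W (x, k) = (T k x, k + 1) := by
  simp [walk, hx]

namespace ModelA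

variable {γ K K₁ c δ₀ : ℝ} {T : ℤ → Torus → Torus} {W : ℤ → Set Torus}

open Classical in
/-- The passage from a site to the next one takes one or three steps, and during this time the
walk stays to the left of the target. -/
lemma walk_passage (H : ModelA γ K K₁ c δ₀ T W) (n : ℤ) (x : Torus) :
    (walk T W)^[if x ∈ W n then 3 else 1] (x, n) =
        (if x ∈ W n then T n (T (n - 1) (T n x)) else T n x, n + 1) ∧
      ∀ t < (if x ∈ W n then 3 else 1), ((walk T W)^[t] (x, n)).2 < n + 1 := by
  by_cases hx : x ∈ W n
  · simp only [hx, if_true]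
    have h1 : T n x ∉ W (n - 1) := fun h =>
      Set.eq_empty_iff_forall_notMem.1 (H.forward_one n) _ ⟨⟨x, hx, rfl⟩, h⟩
    have h2 : T (n - 1) (T n x) ∉ W n := fun h =>
      Set.eq_empty_iff_forall_notMem.1 (H.forward_two n) _ ⟨⟨_, ⟨x, hx, rfl⟩, rfl⟩, h⟩
    have e1 : walk T W (x, n) = (T n x, n - 1) := walk_of_mem hx
    have e2 : walk T W (T n x, n - 1) = (T (n - 1) (T n x), n) := by
      rw [walk_of_notMem h1, sub_add_cancel]
    have e3 : walk T W (T (n - 1) (T n x), n) = (T n (T (n - 1) (T n x)), n + 1) :=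
      walk_of_notMem h2
    refine ⟨by simp [Function.iterate_succ_apply, e1, e2, e3], fun t ht => ?_⟩
    interval_cases t
    · simp
    · simp [e1]
    · simp [Function.iterate_succ_apply, e1, e2]
  · simp only [hx, if_false]
    refine ⟨by simp [walk_of_notMem hx], fun t ht => ?_⟩
    interval_cases t
    simp

open Classical in
lemma passageTime_eq (H : ModelA γ K K₁ c δ₀ T W) (n : ℤ) (x : Torus) :
    passageTime T W n x = if x ∈ W n then 3 else 1 := by
  obtain ⟨h1, h2⟩ := H.walk_passage n x
  exact hittingTime_eq (by rw [h1]) fun t ht => (h2 t ht).ne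

open Classical in
lemma inducedMap_eq (H : ModelA γ K K₁ c δ₀ T W) (n : ℤ) :
    inducedMap T W n = fun x => if x ∈ W n then T n (T (n - 1) (T n x)) else T n x := by
  funext x
  rw [inducedMap, H.passageTime_eq, (H.walk_passage n x).1]

lemma passageTime_eq_indicator (H : ModelA γ K K₁ c δ₀ T W) (n : ℤ) (x : Torus) :
    (passageTime T W n x : ℝ) = 1 + 2 * (W n).indicator (1 : Torus → ℝ) x := by
  classical
  rw [H.passageTime_eq]
  by_cases hx : x ∈ W n <;> simp [hx]
  norm_num

/-- Each passage stays left of its own target until it ends. Hence no site is reached early, and the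
sum of the first `n` passage times is the first arrival at `n`. -/
lemma walk_hitting (H : ModelA γ K K₁ c δ₀ T W) (x : Torus) (n : ℕ) :
    (walk T W)^[∑ i ∈ Finset.range n, passageTime T W i (compFrom (inducedMap T W) 0 i x)] (x, 0) =
        (compFrom (inducedMap T W) 0 n x, (n : ℤ)) ∧
      ∀ t < ∑ i ∈ Finset.range n, passageTime T W i (compFrom (inducedMap T W) 0 i x),
        ((walk T W)^[t] (x, 0)).2 < n := by
  classical
  induction n with
  | zero => simp [compFrom]
  | succ n ih =>
    obtain ⟨ih1, ih2⟩ := ih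
    rw [Finset.sum_range_succ]
    set s := ∑ i ∈ Finset.range n, passageTime T W i (compFrom (inducedMap T W) 0 i x)
    set y := compFrom (inducedMap T W) 0 n x with hy
    obtain ⟨h1, h2⟩ := H.walk_passage n y
    rw [← H.passageTime_eq] at h1 h2
    constructor
    · rw [add_comm, Function.iterate_add_apply, ih1, h1]
      have : compFrom (inducedMap T W) 0 (n + 1) x = inducedMap T W n y := by
        simp [compFrom, hy]
      rw [this, H.inducedMap_eq]
      push_cast
      rfl
    · intro t ht
      push_cast
      rcases lt_or_ge t s with hts | hts
      · have := ih2 t hts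
        omega
      · obtain ⟨r, rfl⟩ := Nat.exists_eq_add_of_le' hts
        rw [Function.iterate_add_apply, ih1]
        exact h2 r (by omega)

lemma hittingTime_eq_sum (H : ModelA γ K K₁ c δ₀ T W) (x : Torus) (n : ℕ) :
    hittingTime T W n x 0 =
      ∑ i ∈ Finset.range n, passageTime T W i (compFrom (inducedMap T W) 0 i x) := by
  obtain ⟨h1, h2⟩ := H.walk_hitting x n
  exact hittingTime_eq (by rw [h1]) fun t ht => (h2 t ht).ne

/-- The rate and the L¹ coefficient are those of a map with two kinds of branches, `T n` and `T n ∘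
T (n - 1) ∘ T n`. They do not involve `δ₀`, so the smallness threshold for the gates can be chosen
afterwards. -/
lemma exists_transferSystem (H : ModelA γ K K₁ c δ₀ T W) (hγ : 3 < γ) (hδ₀ : 0 < δ₀)
    (hδ₁ : δ₀ < 1) :
    ∃ L, TransferSystem (2 * γ⁻¹ + 2 * γ⁻¹ ^ 3)
      (2 * γ⁻¹ + 2 * γ⁻¹ ^ 3 + 4 * (K₁ * (γ⁻¹ * γ⁻¹))) K δ₀ T (inducedMap T W) W L := by
  have hγ0 : 0 < γ := by linarith
  have hK₁ : 0 ≤ K₁ := by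
    obtain ⟨f, f', -, -, -, hlip⟩ := H.expanding 0
    have := (abs_nonneg _).trans (hlip 1 0)
    simpa using this
  have hm : ∀ n, Measurable (T n) := fun n => (H.expanding n).measurable
  choose L₁ hL₁ hK using fun n => (H.expanding n).exists_transfer hγ0
  have hW1 : ∀ n, volume.real (W n) < 1 := fun n => (H.gate_upper n).trans_lt hδ₁
  have hα1 : γ⁻¹ ≤ 1 := inv_le_one_of_one_le₀ (by linarith)
  choose L hL hLK using fun n => exists_transfer_piecewise (hL₁ n) (hL₁ (n - 1)) (hm n) (hm (n - 1))
    (inv_nonneg.2 hγ0.le) hα1 (by positivity) (H.arc n) (hW1 n) (hK n)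
  refine ⟨L, ?_, ?_, H.arc, hδ₀, H.gate_upper, hLK, ?_⟩
  · intro n
    rw [H.inducedMap_eq]
    exact hL n
  · intro n
    classical
    rw [H.inducedMap_eq]
    exact Measurable.ite ((H.arc n).measurableSet (hW1 n))
      ((hm n).comp ((hm (n - 1)).comp (hm n))) (hm n)
  · intro n p q hpq
    obtain ⟨r, hr⟩ := (H.expanding n).exists_interval_subset hγ0 hpq
    refine ⟨r, fun y hy => hr y ⟨hy.1, hy.2.trans ?_⟩⟩
    have := mul_le_mul_of_nonneg_right hγ.le (sub_nonneg.2 hpq)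
    linarith

/-- The centred passage time is twice the centred indicator of the gate. -/
lemma passageTime_sub_integral (H : ModelA γ K K₁ c δ₀ T W) (n : ℤ) {g : Torus → Torus}
    (hg : Measurable g) (hW : MeasurableSet (W n)) (x : Torus) :
    (passageTime T W n (g x) : ℝ) - ∫ y, (passageTime T W n (g y) : ℝ) =
      2 * ((W n).indicator (1 : Torus → ℝ) (g x) -
        ∫ y, (W n).indicator (1 : Torus → ℝ) (g y)) := by
  simp only [H.passageTime_eq_indicator]
  have hi : Integrable fun y => (W n).indicator (1 : Torus → ℝ) (g y) :=
    integrable_of_abs_le (a := 1) ((measurable_one.indicator hW).comp hg) fun y => by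
      have := indicator_one_apply_mem (W n) (g y)
      rw [abs_of_nonneg this.1]
      exact this.2.1
  rw [integral_add (integrable_const _) (hi.const_mul 2), integral_const_mul]
  simp only [integral_const, smul_eq_mul, measureReal_def, UnitAddCircle.measure_univ,
    ENNReal.toReal_one, one_mul]
  ring

lemma measurable_passageTime (H : ModelA γ K K₁ c δ₀ T W) (n : ℤ) (hW : MeasurableSet (W n)) :
    Measurable fun x => (passageTime T W n x : ℝ) := by
  simp only [H.passageTime_eq_indicator]
  exact ((measurable_one.indicator hW).const_mul 2).const_add 1

end ModelA

end DRW
end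

theorem lemma4p1 (γ K K₁ c : ℝ) (hγ : 3 < γ) (hγK : γ ≤ K) (hK₁ : 0 < K₁) (hc : 0 < c) :
    ∃ (δbar : ℝ) (N₀ : ℕ), 0 < δbar ∧ 1 ≤ N₀ ∧
      ∀ (N : ℕ) (δ₀ : ℝ), N₀ ≤ N → 0 < δ₀ → δ₀ ≤ δbar →
        ∃ C : ℝ, 0 < C ∧
          ∀ (T : ℤ → DRW.Torus → DRW.Torus) (W : ℤ → Set DRW.Torus),
            DRW.ModelA' γ K K₁ c δ₀ N T W →
              ∀ n : ℕ,
                C * (n : ℝ) ≤ DRW.sigmaSq T W n ∧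
                C * (n : ℝ) ≤
                  variance (fun x : DRW.Torus => (DRW.hittingTime T W (n : ℤ) x 0 : ℝ)) volume := by
  have hα0 : 0 < γ⁻¹ := inv_pos.2 (by linarith)
  have hα3 : γ⁻¹ ≤ 3⁻¹ := inv_anti₀ (by norm_num) hγ.le
  -- At γ = 3 the rate equals 2/3 + 2/27 = 20/27.
  have hθ1 : 2 * γ⁻¹ + 2 * γ⁻¹ ^ 3 < 1 := by
    have : γ⁻¹ ^ 3 ≤ 3⁻¹ ^ 3 := pow_le_pow_left₀ hα0.le hα3 3
    linarith
  obtain ⟨δ₂, κ, hδ₂, hδ₂1, hκ, hvar⟩ := DRW.TransferSystem.exists_variance_lower_bound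
    (D := 2 * γ⁻¹ + 2 * γ⁻¹ ^ 3 + 4 * (K₁ * (γ⁻¹ * γ⁻¹)))
    (by positivity : 0 ≤ 2 * γ⁻¹ + 2 * γ⁻¹ ^ 3) hθ1 (by positivity) (by linarith : 1 ≤ K) hc
  refine ⟨δ₂, 1, hδ₂, le_rfl, fun N δ₀ _ hδ₀ hle => ⟨4 * (κ * δ₀), by positivity, ?_⟩⟩
  intro T W H' n
  have H := H'.toModelA
  obtain ⟨L, hL⟩ := H.exists_transferSystem hγ hδ₀ (hle.trans_lt hδ₂1)
  have hWm : ∀ n, MeasurableSet (W n) := fun n =>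
    (H.arc n).measurableSet ((H.gate_upper n).trans_lt (hle.trans_lt hδ₂1))
  -- The starting site `s` stays free, and the visited arcs need not be the gates of the sites
  -- reached. With `s = 1` the state after `i` maps belongs to site `i + 1` but is tested against `W
  -- i`, as in `sigmaSq`; with `s = 0` state and gate agree, as for the hitting time.
  have key := fun s F => hvar δ₀ T _ W L hL hle s (fun i : ℕ => W i) (fun i => H.arc i)
    (fun i => H.gate_upper i) (fun i => H.gate_lower i) F
  have hfour : ∀ (s : ℤ) (F : Finset ℕ), 4 * (κ * δ₀) * F.card ≤
      ∫ x, (∑ i ∈ F, ((DRW.passageTime T W i (DRW.compFrom (DRW.inducedMap T W) s i x) : ℝ) -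
        ∫ y, (DRW.passageTime T W i (DRW.compFrom (DRW.inducedMap T W) s i y) : ℝ))) ^ 2 := by
    intro s F
    simp only [H.passageTime_sub_integral _ (hL.measurable_compFrom s _) (hWm _), ← Finset.mul_sum,
      mul_pow, integral_const_mul]
    have := key s F
    linarith
  constructor
  · have := hfour 1 (Finset.Icc 1 n)
    rwa [Nat.card_Icc, Nat.add_sub_cancel] at this
  · have h1 := hfour 0 (Finset.range n)
    rw [Finset.card_range] at h1
    have hm : ∀ i : ℕ, Measurable fun x =>
        (DRW.passageTime T W i (DRW.compFrom (DRW.inducedMap T W) 0 i x) : ℝ) := fun i =>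
      (H.measurable_passageTime i (hWm i)).comp (hL.measurable_compFrom 0 i)
    have hi : ∀ i : ℕ, Integrable fun x =>
        (DRW.passageTime T W i (DRW.compFrom (DRW.inducedMap T W) 0 i x) : ℝ) := fun i =>
      DRW.integrable_of_abs_le (a := 3) (hm i) fun x => by
        rw [H.passageTime_eq_indicator]
        have := DRW.indicator_one_apply_mem (W i) (DRW.compFrom (DRW.inducedMap T W) 0 i x)
        rw [abs_of_nonneg (by linarith)]
        linarith
    have hsum : (fun x : DRW.Torus => (DRW.hittingTime T W (n : ℤ) x 0 : ℝ)) = fun x =>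
        ∑ i ∈ Finset.range n,
          (DRW.passageTime T W i (DRW.compFrom (DRW.inducedMap T W) 0 i x) : ℝ) := by
      funext x
      rw [H.hittingTime_eq_sum]
      push_cast
      rfl
    rw [hsum, variance_eq_integral (Finset.measurable_sum _ fun i _ => hm i).aemeasurable,
      integral_finsetSum _ fun i _ => hi i]
    simpa only [Finset.sum_sub_distrib] using h1
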